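/- Conventions. All manifolds and maps are smooth. An *almost quaternionic structure* on a manifold $M$ is a vector subbundle $Q_M\subseteq\mathrm{End}(TM)$ which is locally spanned by smooth sections $I,J,K$ with $I^2=J^2=K^2=IJK=-\mathrm{Id}$; its *twistor space* is the bundle $\pi_M:Z_M\to M$ of those $J\in Q_M$ with $J^2=-\mathrm{Id}$ (the unit sphere bundle of $Q_M$), an embedded submanifold of $\mathrm{End}(TM)$. An *almost quaternionic connection* is a connection $\nabla$ on $TM$ such that $\nabla_XJ$ is a section of $Q_M$ for any local section $J$ of $Q_M$ and any vector field $X$; for example, the quaternionic connection of a quaternionic manifold is such a connection. Then $\nabla$ induces a connection on $Z_M$, with horizontal distribution $\mathscr{H}\subseteq TZ_M$, and $\mathcal{J}'_M$ denotes the almost complex structure on $Z_M$ which, at $J\in Z_M$, is the horizontal lift of $J$ on $\mathscr{H}_J$ and is $B\mapsto -J\circ B$ on the vertical space $(\ker d\pi_M)_J=\{B\in (Q_M)_{\pi_M(J)} : BJ=-JB\}$; equivalently, its $\mathrm{i}$-eigenbundle is $\mathscr{H}^{1,0}\oplus(\ker d\pi_M)^{0,1}$. Put $\tau'_M=(Z_M,M,\pi_M,\mathcal{J}'_M)$.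 For $J\in Z_M$, $T^{1,0;J}M$ and $T^{0,1;J}M$ denote the eigenspaces of $J$, for $\mathrm{i}$ and $-\mathrm{i}$, in the complexification of $T_{\pi_M(J)}M$. **Proposition.** Let $M$ and $N$ be almost quaternionic manifolds endowed with almost quaternionic connections $\nabla^M$ and $\nabla^N$, respectively (in particular, $M$ and $N$ may be quaternionic manifolds with their quaternionic connections). Let $\varphi:M\to N$ be a map whose differential is nonzero at every point, and let $\varPhi:Z_M\to Z_N$ be a map with $\pi_N\circ\varPhi=\varphi\circ\pi_M$. Suppose that $\varphi$ is quaternionic with respect to $\varPhi$, that is, $d\varphi_{\pi_M(J)}\circ J=\varPhi(J)\circ d\varphi_{\pi_M(J)}$ for any $J\in Z_M$. (Then $\varPhi$ extends, fibrewise, uniquely to linear isomorphisms $(Q_M)_x\to(Q_N)_{\varphi(x)}$, and thus identifies $Q_M=\varphi^*(Q_N)$ and $Z_M=\varphi^*(Z_N)$.) Then the following assertions are equivalent: (i) $\varphi:(M,\tau'_M)\to(N,\tau'_N)$ is twistorial with respect to $\varPhi$; that is, $\varPhi:(Z_M,\mathcal{J}'_M)\to(Z_N,\mathcal{J}'_N)$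 is holomorphic: $d\varPhi\circ\mathcal{J}'_M=\mathcal{J}'_N\circ d\varPhi$. (ii) $(\nabla d\varphi)\bigl(T^{1,0;J}M,\,T^{0,1;J}M\bigr)\subseteq T^{0,1;\varPhi(J)}N$ for any $J\in Z_M$, where $(\nabla d\varphi)(X,Y)=(\nabla_Xd\varphi)(Y)$ is extended complex bilinearly and $\nabla$ is the connection on $\mathrm{Hom}(TM,\varphi^*(TN))$ induced by $\nabla^M$ and $\nabla^N$. (iii) $A(JX)J=-J\circ(A(X)J)$ for any $J\in Z_M$ and $X\in T_{\pi_M(J)}M$, where $A$ is the difference between the connections on $Q_M=\varphi^*(Q_N)$ induced by $\nabla^M$ and $\nabla^N$. -/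

import Mathlib

open Bundle Set Topology
open scoped Manifold ContDiff

noncomputable section

/-- Endomorphisms of the tangent space `T_x M`. -/
abbrev EndT (E : Type*) [NormedAddCommGroup E] [NormedSpace ℝ E]
    {M : Type*} [TopologicalSpace M] [ChartedSpace E M] (x : M) : Type _ :=
  TangentSpace 𝓘(ℝ, E) x →L[ℝ] TangentSpace 𝓘(ℝ, E) x

/-- The total space of the vector bundle `End(TM)`; Mathlib makes it a smooth manifold. -/
abbrev EndBundle (E : Type*) [NormedAddCommGroup E] [NormedSpace ℝ E]
    (M : Type*) [TopologicalSpace M] [ChartedSpace E M] : Type _ :=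
  TotalSpace (E →L[ℝ] E) (fun x : M ↦ EndT E x)

/-- The model with corners of the manifold `End(TM)`. -/
abbrev EndModel (E : Type*) [NormedAddCommGroup E] [NormedSpace ℝ E] :=
  (𝓘(ℝ, E)).prod 𝓘(ℝ, E →L[ℝ] E)

/-- A connection on (the tangent bundle of) `M`; `cov Y x X` is `∇_X Y` at `x`. -/
abbrev TangentConnection (E : Type*) [NormedAddCommGroup E] [NormedSpace ℝ E]
    (M : Type*) [TopologicalSpace M] [ChartedSpace E M] [IsManifold 𝓘(ℝ, E) ∞ M] : Type _ :=
  CovariantDerivative 𝓘(ℝ, E) E (TangentSpace 𝓘(ℝ, E) : M → Type _)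

section Quaternionic

variable {E : Type*} [NormedAddCommGroup E] [NormedSpace ℝ E]
  {M : Type*} [TopologicalSpace M] [ChartedSpace E M] [IsManifold 𝓘(ℝ, E) ∞ M]

/-- The section `s` of `End(TM)` is smooth on `U`. -/
def SmoothEndOn (s : ∀ x : M, EndT E x) (U : Set M) : Prop :=
  ContMDiffOn 𝓘(ℝ, E) (EndModel E) ∞
    (fun x ↦ (⟨x, s x⟩ : EndBundle E M)) U

variable (E M) in
/-- An almost quaternionic structure on `M`, given by the rank three subbundle `Q_M` of `End(TM)`
which is locally spanned by smooth triples satisfying the quaternionic identities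
`I² = J² = K² = IJK = -Id`. -/
structure AlmostQuaternionicStructure where
  /-- The fibres of `Q_M`. -/
  Q : ∀ x : M, Submodule ℝ (EndT E x)
  exists_frame : ∀ x₀ : M, ∃ U : Set M, IsOpen U ∧ x₀ ∈ U ∧
    ∃ I J K : ∀ x : M, EndT E x,
      SmoothEndOn I U ∧ SmoothEndOn J U ∧ SmoothEndOn K U ∧
      ∀ x ∈ U, I x ∘L I x = -ContinuousLinearMap.id ℝ _ ∧
        J x ∘L J x = -ContinuousLinearMap.id ℝ _ ∧
        K x ∘L K x = -ContinuousLinearMap.id ℝ _ ∧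
        I x ∘L J x ∘L K x = -ContinuousLinearMap.id ℝ _ ∧
        Q x = Submodule.span ℝ {I x, J x, K x}

namespace AlmostQuaternionicStructure

/-- The fibre of the twistor space `Z_M` at `x`: the admissible linear complex structures. For
`dim M > 0` this is the unit sphere of `Q_x`, because
`(aI + bJ + cK)² = -(a² + b² + c²) Id`. -/
def Z (S : AlmostQuaternionicStructure E M) (x : M) : Set (EndT E x) :=
  {J | J ∈ S.Q x ∧ J ∘L J = -ContinuousLinearMap.id ℝ _}

/-- The twistor space `Z_M`, as a subset (embedded submanifold) of the manifold `End(TM)`. -/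
def twistorSpace (S : AlmostQuaternionicStructure E M) : Set (EndBundle E M) :=
  {p | p.2 ∈ S.Z p.1}

end AlmostQuaternionicStructure

section Connector

/-- The vector field near `x` which is constant in the preferred trivialization of `TM` at `x` and
equal to `Y` at `x`. -/
def constantExtension (x : M) (Y : TangentSpace 𝓘(ℝ, E) x) (y : M) : TangentSpace 𝓘(ℝ, E) y :=
  let e := trivializationAt E (TangentSpace 𝓘(ℝ, E) : M → Type _) x
  e.symmL ℝ y (e.continuousLinearMapAt ℝ x Y)

theorem mdifferentiableAt_constantExtension (x : M) (Y : TangentSpace 𝓘(ℝ, E) x) :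
    MDifferentiableAt 𝓘(ℝ, E) ((𝓘(ℝ, E)).prod 𝓘(ℝ, E))
      (fun y ↦ (⟨y, constantExtension x Y y⟩ :
        TotalSpace E (TangentSpace 𝓘(ℝ, E) : M → Type _))) x := by
  refine (FiberBundle.mdifferentiableAt_extend 𝓘(ℝ, E) E Y).congr_of_eventuallyEq ?_
  have hx := FiberBundle.mem_baseSet_trivializationAt' (F := E)
    (E := (TangentSpace 𝓘(ℝ, E) : M → Type _)) x
  filter_upwards [(trivializationAt E (TangentSpace 𝓘(ℝ, E) : M → Type _) x).open_baseSet.mem_nhds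
    hx] with y hy
  simp only [constantExtension, FiberBundle.extend]
  rw [Trivialization.symmL_apply _ hy,
    Trivialization.continuousLinearMapAt_apply, Trivialization.linearMapAt_apply, if_pos hx]

variable [FiniteDimensional ℝ E]

/-- The connection form `Γ` at `x` in the preferred trivialization of `TM` at `x`:
`Γ(X) Y = ∇_X Ỹ`, with `Ỹ` the constant extension of `Y`. Thus `∇ = d + Γ` at `x`. -/
def connectionForm (cov : TangentConnection E M) (x : M) (X : TangentSpace 𝓘(ℝ, E) x) :
    EndT E x :=
  haveI : FiniteDimensional ℝ (TangentSpace 𝓘(ℝ, E) x) := inferInstanceAs (FiniteDimensional ℝ E)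
  haveI : T2Space (TangentSpace 𝓘(ℝ, E) x) := inferInstanceAs (T2Space E)
  LinearMap.toContinuousLinearMap
    { toFun := fun Y ↦ cov (constantExtension x Y) x X
      map_add' := fun Y Y' ↦ by
        have h := cov.isCovariantDerivativeOnUniv.add
          (mdifferentiableAt_constantExtension x Y) (mdifferentiableAt_constantExtension x Y')
        have h' : constantExtension x (Y + Y')
            = constantExtension x Y + constantExtension x Y' := by
          funext y
          simp [constantExtension]
        rw [h']
        exact congrArg (fun L : TangentSpace 𝓘(ℝ, E) x →L[ℝ] TangentSpace 𝓘(ℝ, E) x ↦ L X) h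
      map_smul' := fun c Y ↦ by
        have h := cov.isCovariantDerivativeOnUniv.smul_const c
          (mdifferentiableAt_constantExtension x Y)
        have h' : constantExtension x (c • Y) = c • constantExtension x Y := by
          funext y
          simp [constantExtension]
        rw [h']
        exact congrArg (fun L : TangentSpace 𝓘(ℝ, E) x →L[ℝ] TangentSpace 𝓘(ℝ, E) x ↦ L X) h }

/-- The fibre coordinate on `End(TM)` given by the preferred trivialization at `x`. On the fibre
over `x` it is the identity of `End(T_x M)`. -/
def endCoord (x : M) (q : EndBundle E M) : E →L[ℝ] E :=
  (trivializationAt (E →L[ℝ] E) (fun y : M ↦ EndT E y) x q).2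

/-- The differential at `p` of the projection `π : End(TM) → M`. -/
def dproj (p : EndBundle E M) :
    TangentSpace (EndModel E) p →L[ℝ] TangentSpace 𝓘(ℝ, E) p.1 :=
  mfderiv (EndModel E) 𝓘(ℝ, E) (TotalSpace.proj : EndBundle E M → M) p

/-- The connector `T_p End(TM) → End(T_x M)`, `x = π(p)`, of the connection on `End(TM)` induced by
`∇`, which is `d + [Γ, ·]` in the trivialization at `x`. On vertical vectors it is the
identity, and its kernel is the horizontal subspace at `p`. If `s` is a map from a
manifold to `End(TM)`, that is, a section of the pullback of `End(TM)` by `f = π ∘ s`, then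
`connector (ds(X))` is the covariant derivative of `s` along `X` with respect to the pullback
by `f` of the connection induced by `∇`. -/
def connector (cov : TangentConnection E M) (p : EndBundle E M)
    (v : TangentSpace (EndModel E) p) : EndT E p.1 :=
  let dcoord : EndT E p.1 :=
    (mfderiv (EndModel E) 𝓘(ℝ, E →L[ℝ] E) (endCoord p.1) p v : E →L[ℝ] E)
  let Γ : EndT E p.1 := connectionForm cov p.1 (dproj p v)
  dcoord + (Γ ∘L p.2 - p.2 ∘L Γ)

/-- `∇` is an almost quaternionic connection: it is smooth and induces a connection on `Q_M`, that
is, `∇_X s` is in `Q_M` for every local smooth section `s` of `Q_M`. -/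
structure IsAlmostQuaternionicConnection (S : AlmostQuaternionicStructure E M)
    (cov : TangentConnection E M) : Prop where
  smooth : CovariantDerivative.ContMDiffCovariantDerivative cov ∞
  preserves : ∀ (U : Set M) (s : ∀ x : M, EndT E x), IsOpen U → SmoothEndOn s U →
    (∀ x ∈ U, s x ∈ S.Q x) → ∀ x ∈ U, ∀ X : TangentSpace 𝓘(ℝ, E) x,
      connector cov ⟨x, s x⟩
        (mfderiv 𝓘(ℝ, E) (EndModel E) (fun y ↦ (⟨y, s y⟩ : EndBundle E M)) x X) ∈ S.Q x

/-- The tangent space at `p ∈ Z_M` to the twistor space, as the direct sum of the horizontal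
space and of the space of vertical vectors tangent to the fibre of `Z_M`. With `J = p.2`,
the latter is identified, through the connector, with the set of `B ∈ Q_M` which are orthogonal to
`J`, equivalently which anticommute with `J`. -/
def twistorTangent (S : AlmostQuaternionicStructure E M) (cov : TangentConnection E M)
    (p : EndBundle E M) : Set (TangentSpace (EndModel E) p) :=
  {v | connector cov p v ∈ S.Q p.1 ∧ connector cov p v ∘L p.2 = -(p.2 ∘L connector cov p v)}

/-- The graph of the almost complex structure `𝒥'` on `Z_M`, at `p ∈ Z_M`: both vectors are tangent
to `Z_M` and `w = 𝒥' v`. With `J = p.2`, the structure `𝒥'` is the horizontal lift of `J` on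
the horizontal space and it is the opposite of the complex structure `B ↦ J ∘ B` of the fibre on
the vertical space; that is, its `i`-eigenspace is `ℋ^{1,0} ⊕ (ker dπ)^{0,1}`. -/
def IsJPrime (S : AlmostQuaternionicStructure E M) (cov : TangentConnection E M)
    (p : EndBundle E M) (v w : TangentSpace (EndModel E) p) : Prop :=
  v ∈ twistorTangent S cov p ∧ w ∈ twistorTangent S cov p ∧
    dproj p w = p.2 (dproj p v) ∧ connector cov p w = -(p.2 ∘L connector cov p v)

end Connector
end Quaternionic

section Complexification

variable {V W : Type*} [AddCommGroup V] [Module ℝ V] [TopologicalSpace V] [AddCommGroup W]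

/-- `V^{1,0;J}`, in the complexification of `V`: the pair `(a, b)` stands for `a + i b`, and the
condition is `J (a + i b) = i (a + i b)`. -/
def eigenspace10 (J : V →L[ℝ] V) : Set (V × V) :=
  {z | J z.1 = -z.2 ∧ J z.2 = z.1}

/-- `V^{0,1;J}`, in the complexification of `V`: the pair `(a, b)` stands for `a + i b`, and the
condition is `J (a + i b) = -i (a + i b)`. -/
def eigenspace01 (J : V →L[ℝ] V) : Set (V × V) :=
  {z | J z.1 = z.2 ∧ J z.2 = -z.1}

/-- The complex bilinear extension of a real bilinear map; pairs `(a, b)` stand for `a + i b`. -/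
def complexBilinear (B : V → V → W) (z w : V × V) : W × W :=
  (B z.1 w.1 - B z.2 w.2, B z.1 w.2 + B z.2 w.1)

end Complexification

section Maps

variable {E : Type*} [NormedAddCommGroup E] [NormedSpace ℝ E]
  {M : Type*} [TopologicalSpace M] [ChartedSpace E M] [IsManifold 𝓘(ℝ, E) ∞ M]
  {F : Type*} [NormedAddCommGroup F] [NormedSpace ℝ F]
  {N : Type*} [TopologicalSpace N] [ChartedSpace F N] [IsManifold 𝓘(ℝ, F) ∞ N]

/-- A map `Φ : Z_M → Z_N` with `π_N ∘ Φ = φ ∘ π_M`, given by its restrictions to the fibres. -/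
abbrev TwistorLift (S : AlmostQuaternionicStructure E M) (T : AlmostQuaternionicStructure F N)
    (φ : M → N) : Type _ :=
  ∀ x : M, S.Z x → T.Z (φ x)

variable {S : AlmostQuaternionicStructure E M} {T : AlmostQuaternionicStructure F N} {φ : M → N}

open Classical in
/-- `Φ : Z_M → Z_N` as a map into `End(TN)`; the values outside `Z_M` are irrelevant. -/
def TwistorLift.toMap (Φ : TwistorLift S T φ) (p : EndBundle E M) : EndBundle F N :=
  if h : p.2 ∈ S.Z p.1 then ⟨φ p.1, (Φ p.1 ⟨p.2, h⟩ : EndT F (φ p.1))⟩ else ⟨φ p.1, 0⟩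

/-- `Φ : Z_M → Z_N` is smooth. -/
def TwistorLift.IsSmooth (Φ : TwistorLift S T φ) : Prop :=
  ContMDiffOn (EndModel E) (EndModel F) ∞ Φ.toMap S.twistorSpace

/-- `φ` is a quaternionic map with respect to `Φ`. -/
def IsQuaternionicMap (Φ : TwistorLift S T φ) : Prop :=
  ∀ (x : M) (J : S.Z x),
    mfderiv 𝓘(ℝ, E) 𝓘(ℝ, F) φ x ∘L (J : EndT E x)
      = (Φ x J : EndT F (φ x)) ∘L mfderiv 𝓘(ℝ, E) 𝓘(ℝ, F) φ x

open Classical in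
/-- The linear extension `Q_M → Q_N` of `Φ` at `x`, through which `Q_M = φ^*(Q_N)`. Its values on
`Q_x` are determined, as `Z_x` spans `Q_x`; the other values are irrelevant. -/
def TwistorLift.linearExtension (Φ : TwistorLift S T φ) (x : M) :
    EndT E x →ₗ[ℝ] EndT F (φ x) :=
  if h : ∃ L : EndT E x →ₗ[ℝ] EndT F (φ x), ∀ J : S.Z x, L J = (Φ x J : EndT F (φ x))
  then h.choose else 0

variable [FiniteDimensional ℝ E] [FiniteDimensional ℝ F]

/-- `φ : (M, τ'_M) → (N, τ'_N)` is twistorial with respect to `Φ`: the map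
`Φ : (Z_M, 𝒥'_M) → (Z_N, 𝒥'_N)` is holomorphic, that is, it is smooth and its differential
intertwines `𝒥'_M` and `𝒥'_N`. -/
def IsTwistorialPrime (covM : TangentConnection E M) (covN : TangentConnection F N)
    (Φ : TwistorLift S T φ) : Prop :=
  Φ.IsSmooth ∧ ∀ p ∈ S.twistorSpace, ∀ v w : TangentSpace (EndModel E) p,
    IsJPrime S covM p v w →
    IsJPrime T covN (Φ.toMap p)
      (mfderivWithin (EndModel E) (EndModel F) Φ.toMap S.twistorSpace p v)
      (mfderivWithin (EndModel E) (EndModel F) Φ.toMap S.twistorSpace p w)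

/-- `(∇dφ)(X, Y) = (∇_X dφ)(Y)`, where `∇` is the connection on `Hom(TM, φ^*(TN))` induced by
`∇^M` and `∇^N`. In the preferred trivializations at `x` and `φ(x)` this is
`(∂_X dφ)(Y) + Γ^N(dφ X)(dφ Y) - dφ(Γ^M(X) Y)`. -/
def hessian (covM : TangentConnection E M) (covN : TangentConnection F N) (φ : M → N) (x : M)
    (X Y : TangentSpace 𝓘(ℝ, E) x) : TangentSpace 𝓘(ℝ, F) (φ x) :=
  let dφ := mfderiv 𝓘(ℝ, E) 𝓘(ℝ, F) φ x
  let D : TangentSpace 𝓘(ℝ, E) x →L[ℝ] TangentSpace 𝓘(ℝ, F) (φ x) := (mfderiv 𝓘(ℝ, E) 𝓘(ℝ, E →L[ℝ] F)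
    (inTangentCoordinates 𝓘(ℝ, E) 𝓘(ℝ, F) id φ (fun y ↦ mfderiv 𝓘(ℝ, E) 𝓘(ℝ, F) φ y) x) x X : E →L[ℝ] F)
  D Y + connectionForm covN (φ x) (dφ X) (dφ Y) - dφ (connectionForm covM x X Y)

/-- `A(X)s` at `x`, for a local section `s` of `Z_M`, where `A` is the difference between the
connections on `Q_M = φ^*(Q_N)` induced by `∇^N` and `∇^M`; it is viewed in `φ^*(Q_N)`, so that
it is `∇^N_X (Φ ∘ s) - Φ(∇^M_X s)`. -/
def connectionDifference (covM : TangentConnection E M) (covN : TangentConnection F N)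
    (Φ : TwistorLift S T φ) (s : ∀ x : M, S.Z x) (x : M) (X : TangentSpace 𝓘(ℝ, E) x) :
    EndT F (φ x) :=
  connector covN ⟨φ x, (Φ x (s x) : EndT F (φ x))⟩
      (mfderiv 𝓘(ℝ, E) (EndModel F)
        (fun y ↦ (⟨φ y, (Φ y (s y) : EndT F (φ y))⟩ : EndBundle F N)) x X)
    - Φ.linearExtension x (connector covM ⟨x, (s x : EndT E x)⟩
      (mfderiv 𝓘(ℝ, E) (EndModel E) (fun y ↦ (⟨y, (s y : EndT E y)⟩ : EndBundle E M)) x X))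

end Maps

end

/-! Let `L` be the linear extension of `Φ` to `Q_M`, let `s` be a local section of `Z_M`, and let
`A(X)s = ∇^N_X (Φ ∘ s) - L(∇^M_X s)`. Everything rests on two formulas.

The first describes `dΦ` (`tangentMap_apply`). A vector `v` tangent to `Z_M` at `s x`, over `X` and
with vertical part `B`, is `ds(X)` plus a vertical vector. Since `Φ` is linear on fibres, it acts on
vertical vectors by `L`. Hence `dΦ v` lies over `dφ X` and has vertical part `L B + A(X)s`. The map
`L` is compatible with composition by `J` on the elements of `Q_M` anticommuting with `J`, and `dφ`
intertwines `J` and `Φ(J)`. The only obstruction to holomorphy is therefore the term `A(X)s`, which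
must satisfy `A(JX)s = -Φ(J) ∘ A(X)s` (`isJPrime_iff`).

The second is the covariant derivative of `dφ ∘ s = Φ(s) ∘ dφ`, namely `(∇dφ)(X, JY) = Φ(J) (∇dφ)(X,
Y) + (A(X)s)(dφ Y)` (`hessian_complex`). On `X - iJX` and `Y + iJY`, the type condition on `∇dφ`
becomes `(A(X)s)(dφ Y) = Φ(J) (A(JX)s)(dφ Y)`. Both operators lie in `Q_N`, whose nonzero elements
are injective, and `dφ ≠ 0`; so `dφ Y` can be dropped and the same condition on `A` remains
(`complexBilinear_mem_eigenspace01_iff`).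

A smooth local section passes through every point of `Z_M` (`exists_twistor_section`), so these
pointwise equivalences give the global ones. -/

noncomputable section

/-! ### Algebra of a space of imaginary quaternions inside a real algebra -/

section QuaternionicAlgebra

variable {R : Type*} [Ring R] [Algebra ℝ R]

/-- A subspace of a real algebra spanned by a triple satisfying the quaternionic identities. -/
def IsQuaternionicSubspace (Q : Submodule ℝ R) : Prop :=
  ∃ I J K : R, I * I = -1 ∧ J * J = -1 ∧ K * K = -1 ∧ I * (J * K) = -1 ∧
    Q = Submodule.span ℝ {I, J, K}

omit [Algebra ℝ R] in
theorem sub_anticommute {A B J : R} (hA : A * J = -(J * A)) (hB : B * J = -(J * B)) :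
    (A - B) * J = -(J * (A - B)) := by
  rw [sub_mul, hA, hB]
  noncomm_ring

omit [Algebra ℝ R] in
theorem quaternionic_relations {I J K : R} (hI : I * I = -1) (hJ : J * J = -1) (hK : K * K = -1)
    (hIJK : I * (J * K) = -1) :
    J * K = I ∧ K * J = -I ∧ I * J = K ∧ J * I = -K ∧ K * I = J ∧ I * K = -J := by
  have h1 : J * K = I := by
    have : I * (I * (J * K)) = I * -1 := by rw [hIJK]
    rw [← mul_assoc, hI] at this
    simpa using this
  have h2 : I * J = K := by
    have : (I * (J * K)) * K = -1 * K := by rw [hIJK]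
    rw [mul_assoc, mul_assoc, hK] at this
    simpa using this
  have h3 : I * K = -J := by rw [← h2, ← mul_assoc, hI]; simp
  have h4 : J * I = -K := by rw [← h1, ← mul_assoc, hJ]; simp
  have h5 : K * J = -I := by rw [← h2, mul_assoc, hJ]; simp
  have h6 : K * I = J := by
    have : K * (J * K) = -I * K := by rw [← mul_assoc, h5]
    rw [h1] at this
    simpa [h3] using this
  exact ⟨h1, h5, h2, h4, h6, h3⟩

theorem quaternionic_anticommutator {I J K : R} (hI : I * I = -1) (hJ : J * J = -1)
    (hK : K * K = -1) (hIJK : I * (J * K) = -1) (a b c a' b' c' : ℝ) :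
    (a • I + b • J + c • K) * (a' • I + b' • J + c' • K)
      + (a' • I + b' • J + c' • K) * (a • I + b • J + c • K)
      = (-2 * (a * a' + b * b' + c * c')) • (1 : R) := by
  obtain ⟨h1, h2, h3, h4, h5, h6⟩ := quaternionic_relations hI hJ hK hIJK
  simp only [mul_add, add_mul, smul_mul_smul_comm, hI, hJ, hK, h1, h2, h3, h4, h5, h6]
  module

theorem quaternionic_sq {I J K : R} (hI : I * I = -1) (hJ : J * J = -1)
    (hK : K * K = -1) (hIJK : I * (J * K) = -1) (a b c : ℝ) :
    (a • I + b • J + c • K) * (a • I + b • J + c • K) = (-(a * a + b * b + c * c)) • (1 : R) := by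
  obtain ⟨h1, h2, h3, h4, h5, h6⟩ := quaternionic_relations hI hJ hK hIJK
  simp only [mul_add, add_mul, smul_mul_smul_comm, hI, hJ, hK, h1, h2, h3, h4, h5, h6]
  module

theorem quaternionic_commutator {I J K : R} (hI : I * I = -1) (hJ : J * J = -1)
    (hK : K * K = -1) (hIJK : I * (J * K) = -1) (a b c a' b' c' : ℝ) :
    (a • I + b • J + c • K) * (a' • I + b' • J + c' • K)
      - (a' • I + b' • J + c' • K) * (a • I + b • J + c • K)
      = (2 * (b * c' - c * b')) • I + (2 * (c * a' - a * c')) • J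
        + (2 * (a * b' - b * a')) • K := by
  obtain ⟨h1, h2, h3, h4, h5, h6⟩ := quaternionic_relations hI hJ hK hIJK
  simp only [mul_add, add_mul, smul_mul_smul_comm, hI, hJ, hK, h1, h2, h3, h4, h5, h6]
  module

theorem mem_span_triple_iff {I J K q : R} :
    q ∈ Submodule.span ℝ {I, J, K} ↔ ∃ a b c : ℝ, q = a • I + b • J + c • K := by
  rw [Submodule.mem_span_triple]
  simp only [eq_comm]

namespace IsQuaternionicSubspace

variable {Q : Submodule ℝ R} (hQ : IsQuaternionicSubspace Q)
include hQ

theorem anticommutator {q r : R} (hq : q ∈ Q) (hr : r ∈ Q) :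
    ∃ t : ℝ, q * r + r * q = t • (1 : R) := by
  obtain ⟨I, J, K, hI, hJ, hK, hIJK, rfl⟩ := hQ
  obtain ⟨a, b, c, rfl⟩ := mem_span_triple_iff.1 hq
  obtain ⟨a', b', c', rfl⟩ := mem_span_triple_iff.1 hr
  exact ⟨_, quaternionic_anticommutator hI hJ hK hIJK ..⟩

theorem commutator_mem {q r : R} (hq : q ∈ Q) (hr : r ∈ Q) : q * r - r * q ∈ Q := by
  obtain ⟨I, J, K, hI, hJ, hK, hIJK, rfl⟩ := hQ
  obtain ⟨a, b, c, rfl⟩ := mem_span_triple_iff.1 hq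
  obtain ⟨a', b', c', rfl⟩ := mem_span_triple_iff.1 hr
  exact mem_span_triple_iff.2 ⟨_, _, _, quaternionic_commutator hI hJ hK hIJK ..⟩

/-- For anticommuting elements the product is half the commutator, and commutators stay in `Q`. -/
theorem mul_mem_of_anticommute {q r : R} (hq : q ∈ Q) (hr : r ∈ Q) (h : r * q = -(q * r)) :
    q * r ∈ Q := by
  have := Q.smul_mem (1 / 2 : ℝ) (hQ.commutator_mem hq hr)
  rw [h] at this
  convert this using 1
  module

/-- The number `n` is `a² + b² + c²` in a quaternionic basis, the squared norm of `q`. -/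
theorem sq_eq {q : R} (hq : q ∈ Q) :
    ∃ n : ℝ, 0 ≤ n ∧ q * q = (-n) • (1 : R) ∧ (n = 0 → q = 0) := by
  obtain ⟨I, J, K, hI, hJ, hK, hIJK, rfl⟩ := hQ
  obtain ⟨a, b, c, rfl⟩ := mem_span_triple_iff.1 hq
  have hn : 0 ≤ a * a + b * b + c * c :=
    add_nonneg (add_nonneg (mul_self_nonneg a) (mul_self_nonneg b)) (mul_self_nonneg c)
  refine ⟨a * a + b * b + c * c, hn, quaternionic_sq hI hJ hK hIJK a b c, fun h ↦ ?_⟩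
  have ha : a = 0 := by nlinarith [mul_self_nonneg a, mul_self_nonneg b, mul_self_nonneg c]
  have hb : b = 0 := by nlinarith [mul_self_nonneg a, mul_self_nonneg b, mul_self_nonneg c]
  have hc : c = 0 := by nlinarith [mul_self_nonneg a, mul_self_nonneg b, mul_self_nonneg c]
  simp [ha, hb, hc]

theorem exists_unit_mul {q : R} (hq : q ∈ Q) (h0 : q ≠ 0) :
    ∃ (β : ℝ) (u : R), u ∈ Q ∧ u * u = -1 ∧ q = β • u := by
  obtain ⟨n, hn, hsq, hn0⟩ := hQ.sq_eq hq
  have hn' : 0 < n := lt_of_le_of_ne hn fun h ↦ h0 (hn0 h.symm)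
  have hs := Real.sqrt_pos.2 hn'
  refine ⟨√n, (√n)⁻¹ • q, Q.smul_mem _ hq, ?_, ?_⟩
  · rw [smul_mul_smul_comm, hsq, smul_smul, ← mul_inv, Real.mul_self_sqrt hn]
    rw [mul_neg, inv_mul_cancel₀ hn'.ne']
    simp
  · rw [smul_smul, mul_inv_cancel₀ hs.ne', one_smul]

theorem exists_unit_generators :
    ∃ I J K : R, I * I = -1 ∧ J * J = -1 ∧ K * K = -1 ∧ I ∈ Q ∧ J ∈ Q ∧ K ∈ Q ∧
      Q = Submodule.span ℝ {I, J, K} := by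
  obtain ⟨I, J, K, hI, hJ, hK, hIJK, h⟩ := hQ
  exact ⟨I, J, K, hI, hJ, hK, h ▸ Submodule.subset_span (by simp),
    h ▸ Submodule.subset_span (by simp), h ▸ Submodule.subset_span (by simp), h⟩

theorem span_units : Q = Submodule.span ℝ {q | q ∈ Q ∧ q * q = -1} := by
  obtain ⟨I, J, K, hI, hJ, hK, hI', hJ', hK', h⟩ := hQ.exists_unit_generators
  apply le_antisymm
  · conv_lhs => rw [h]
    refine Submodule.span_mono ?_
    rintro q (rfl | rfl | rfl)
    exacts [⟨hI', hI⟩, ⟨hJ', hJ⟩, ⟨hK', hK⟩]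
  · exact Submodule.span_le.2 fun q hq ↦ hq.1

end IsQuaternionicSubspace

/-! ### Quaternionic subspaces acting on vector spaces -/

section Operators

variable {V : Type*} [NormedAddCommGroup V] [NormedSpace ℝ V]
  {Q : Submodule ℝ (V →L[ℝ] V)} (hQ : IsQuaternionicSubspace Q)
include hQ

/-- If `q v = -t v`, then `q² v = t² v`, while `q² = -n` with `n ≥ 0`; hence `t² + n = 0`. This is
the invertibility of a nonzero quaternion, and it lets identities in `Q` be tested on a single
nonzero vector. -/
theorem IsQuaternionicSubspace.eq_zero_of_smul_add_apply {q : V →L[ℝ] V} (hq : q ∈ Q)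
    (t : ℝ) {v : V} (hv : v ≠ 0) (h : t • v + q v = 0) : t = 0 ∧ q = 0 := by
  obtain ⟨n, hn, hsq, hn0⟩ := hQ.sq_eq hq
  have h1 : q (q v) = (-n) • v := by simpa using congrArg (fun f : V →L[ℝ] V ↦ f v) hsq
  have h2 : q v = (-t) • v := by
    rw [neg_smul]; exact eq_neg_of_add_eq_zero_right h
  rw [h2, map_smul, h2, smul_smul] at h1
  have h3 : (t * t + n) • v = 0 := by
    have : (t * t + n) • v = (-t * -t) • v - (-n) • v := by module
    rw [this, h1, sub_self]
  have h4 := (smul_eq_zero.1 h3).resolve_right hv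
  have : n = 0 := by nlinarith [mul_self_nonneg t]
  refine ⟨by nlinarith [mul_self_nonneg t], hn0 this⟩

theorem IsQuaternionicSubspace.eq_zero_of_apply {q : V →L[ℝ] V} (hq : q ∈ Q)
    {v : V} (hv : v ≠ 0) (h : q v = 0) : q = 0 :=
  (hQ.eq_zero_of_smul_add_apply hq 0 hv (by simpa using h)).2

omit hQ in
/-- Linear maps `L B` intertwined by `d` with the elements `B` of a quaternionic subspace `Q`
lie in the subspace `Q'` as soon as this is so for the unit elements of `Q`. -/
theorem IsQuaternionicSubspace.intertwining_of_units
    {W : Type*} [NormedAddCommGroup W] [NormedSpace ℝ W]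
    (hQ : IsQuaternionicSubspace Q) {Q' : Submodule ℝ (W →L[ℝ] W)} {d : V →L[ℝ] W}
    {L : (V →L[ℝ] V) →ₗ[ℝ] (W →L[ℝ] W)}
    (hL : ∀ J ∈ Q, J * J = -1 → L J ∈ Q' ∧ d ∘L J = L J ∘L d) {B : V →L[ℝ] V} (hB : B ∈ Q) :
    L B ∈ Q' ∧ d ∘L B = L B ∘L d := by
  rw [hQ.span_units] at hB
  induction hB using Submodule.span_induction with
  | mem q hq => exact hL q hq.1 hq.2
  | zero => simp
  | add p q _ _ hp hq =>
    rw [map_add, ContinuousLinearMap.comp_add, ContinuousLinearMap.add_comp, hp.2, hq.2]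
    exact ⟨Q'.add_mem hp.1 hq.1, rfl⟩
  | smul c q _ hq =>
    rw [map_smul, ContinuousLinearMap.comp_smul, ContinuousLinearMap.smul_comp, hq.2]
    exact ⟨Q'.smul_mem _ hq.1, rfl⟩

-- Both identities are tested on one vector `d v ≠ 0`, where `L B` acts through `B`. The
-- anticommutator of `L B` and `L J` is a scalar that kills `d v`; the difference `L (J * B) - L J *
-- L B` is an element of `Q'` that kills `d v`.
omit hQ in
theorem IsQuaternionicSubspace.intertwining_mul
    {W : Type*} [NormedAddCommGroup W] [NormedSpace ℝ W]
    (hQ : IsQuaternionicSubspace Q) {Q' : Submodule ℝ (W →L[ℝ] W)}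
    (hQ' : IsQuaternionicSubspace Q') {d : V →L[ℝ] W} (hd : d ≠ 0)
    {L : (V →L[ℝ] V) →ₗ[ℝ] (W →L[ℝ] W)}
    (hL : ∀ B ∈ Q, L B ∈ Q' ∧ d ∘L B = L B ∘L d) {J B : V →L[ℝ] V} (hJ : J ∈ Q) (hB : B ∈ Q)
    (h : B * J = -(J * B)) :
    L B * L J = -(L J * L B) ∧ L (J * B) = L J * L B := by
  obtain ⟨v, hv⟩ : ∃ v, d v ≠ 0 := by
    by_contra! hc
    exact hd (ContinuousLinearMap.ext hc)
  have hap : ∀ B ∈ Q, ∀ w, L B (d w) = d (B w) := fun B hB w ↦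
    (congrArg (fun f : V →L[ℝ] W ↦ f w) (hL B hB).2).symm
  have h1 : L B * L J = -(L J * L B) := by
    obtain ⟨t, ht⟩ := hQ'.anticommutator (hL B hB).1 (hL J hJ).1
    have h2 : d ((B * J) v) + d ((J * B) v) = t • d v := by
      have := congrArg (fun f : W →L[ℝ] W ↦ f (d v)) ht
      simpa [hap B hB, hap J hJ] using this
    rw [h] at h2
    have h3 : t = 0 := by
      refine (smul_eq_zero.1 (h2.symm.trans ?_)).resolve_right hv
      simp
    rw [h3, zero_smul] at ht
    exact eq_neg_of_add_eq_zero_left ht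
  refine ⟨h1, ?_⟩
  have hJB := hQ.mul_mem_of_anticommute hJ hB h
  have hmem := Q'.sub_mem (hL _ hJB).1 (hQ'.mul_mem_of_anticommute (hL J hJ).1 (hL B hB).1 h1)
  refine sub_eq_zero.1 (hQ'.eq_zero_of_apply hmem hv ?_)
  simp [hap B hB, hap J hJ, hap _ hJB]

end Operators
end QuaternionicAlgebra

/-! ### The bundle `End(TM)` and the connector in preferred trivializations -/

section Coordinates

variable {E : Type*} [NormedAddCommGroup E] [NormedSpace ℝ E]
  {M : Type*} [TopologicalSpace M] [ChartedSpace E M] [IsManifold 𝓘(ℝ, E) ∞ M]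
  {G : Type*} [NormedAddCommGroup G] [NormedSpace ℝ G]
  {P : Type*} [TopologicalSpace P] [ChartedSpace G P]

theorem tangentCoordinates_self (x : M) (v : E) :
    (trivializationAt E (TangentSpace 𝓘(ℝ, E) : M → Type _) x).continuousLinearMapAt ℝ x v = v := by
  rw [TangentBundle.continuousLinearMapAt_trivializationAt_eq_core (mem_chart_source E x)]
  exact (tangentBundleCore 𝓘(ℝ, E) M).coordChange_self _ _ (mem_chart_source E x) _

theorem tangentCoordinates_symm_self (x : M) (v : E) :
    (trivializationAt E (TangentSpace 𝓘(ℝ, E) : M → Type _) x).symmL ℝ x v = v := by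
  rw [TangentBundle.symmL_trivializationAt_eq_core (mem_chart_source E x)]
  exact (tangentBundleCore 𝓘(ℝ, E) M).coordChange_self _ _ (mem_chart_source E x) _

theorem endCoord_eq (x : M) (q : EndBundle E M) :
    endCoord x q =
      (trivializationAt E (TangentSpace 𝓘(ℝ, E) : M → Type _) x).continuousLinearMapAt ℝ q.1
      ∘L q.2 ∘L (trivializationAt E (TangentSpace 𝓘(ℝ, E) : M → Type _) x).symmL ℝ q.1 :=
  rfl

theorem endCoord_self (x : M) (A : EndT E x) : endCoord x ⟨x, A⟩ = A := by
  ext v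
  refine (tangentCoordinates_self x _).trans ?_
  exact congrArg A (tangentCoordinates_symm_self x v)

theorem endCoord_comp {x y : M}
    (hy : y ∈ (trivializationAt E (TangentSpace 𝓘(ℝ, E) : M → Type _) x).baseSet)
    (A B : EndT E y) :
    endCoord x ⟨y, A ∘L B⟩ = endCoord x ⟨y, A⟩ * endCoord x ⟨y, B⟩ := by
  ext v
  simp only [endCoord_eq, ContinuousLinearMap.comp_apply, mul_apply_eq_comp]
  rw [Trivialization.symmL_continuousLinearMapAt _ hy]

theorem endCoord_neg_id {x y : M}
    (hy : y ∈ (trivializationAt E (TangentSpace 𝓘(ℝ, E) : M → Type _) x).baseSet) :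
    endCoord x ⟨y, -ContinuousLinearMap.id ℝ (TangentSpace 𝓘(ℝ, E) y)⟩ = -1 := by
  ext v
  have := Trivialization.continuousLinearMapAt_symmL (R := ℝ) _ hy v
  simp only [endCoord_eq, ContinuousLinearMap.comp_apply, neg_apply, map_neg,
    ContinuousLinearMap.id_apply, one_apply_eq_self, this]

theorem endCoord_lincomb (x : M) {y : M} (a b c : ℝ) (A B C : EndT E y) :
    endCoord x ⟨y, a • A + b • B + c • C⟩
      = a • endCoord x ⟨y, A⟩ + b • endCoord x ⟨y, B⟩ + c • endCoord x ⟨y, C⟩ := by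
  ext v
  simp only [endCoord_eq, ContinuousLinearMap.comp_apply, add_apply,
    smul_apply, map_add, map_smul]

theorem mdifferentiableAt_endCoord (p : EndBundle E M) :
    MDifferentiableAt (EndModel E) 𝓘(ℝ, E →L[ℝ] E) (endCoord p.1) p :=
  ((mdifferentiableAt_totalSpace 𝓘(ℝ, E) (fun q : EndBundle E M ↦ q)).1 mdifferentiableAt_id).2

theorem mdifferentiableAt_endProj (p : EndBundle E M) :
    MDifferentiableAt (EndModel E) 𝓘(ℝ, E) (TotalSpace.proj : EndBundle E M → M) p :=
  mdifferentiableAt_proj _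

/-- The two maps are the components of a trivialization, whose differential is injective. -/
theorem eq_zero_of_dproj_of_endCoord {p : EndBundle E M} {v : TangentSpace (EndModel E) p}
    (h1 : dproj p v = 0) (h2 : mfderiv (EndModel E) 𝓘(ℝ, E →L[ℝ] E) (endCoord p.1) p v = 0) :
    v = 0 := by
  have he := (trivializationAt (E →L[ℝ] E) (fun y : M ↦ EndT E y) p.1).mdifferentiable
    (I := 𝓘(ℝ, E))
  have hp : p ∈ (trivializationAt (E →L[ℝ] E) (fun y : M ↦ EndT E y) p.1).source :=
    FiberBundle.mem_trivializationAt_proj_source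
  have hinj := he.mfderiv_injective hp
  apply hinj
  have hprod := (mdifferentiableAt_endProj p).mfderiv_prod (mdifferentiableAt_endCoord p)
  have heq : (fun q : EndBundle E M ↦ (q.proj, endCoord p.1 q)) =
    (trivializationAt (E →L[ℝ] E) (fun y : M ↦ EndT E y) p.1) := rfl
  rw [heq] at hprod
  refine Eq.trans ?_ (ContinuousLinearMap.map_zero _).symm
  refine (congrArg (fun L ↦ L v) hprod).trans ?_
  exact Prod.ext h1 h2

section Connector

variable [FiniteDimensional ℝ E]

theorem connectionForm_add (cov : TangentConnection E M) (x : M) (X Y : TangentSpace 𝓘(ℝ, E) x) :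
    connectionForm cov x (X + Y) = connectionForm cov x X + connectionForm cov x Y := by
  ext Z
  exact (cov (constantExtension x Z) x).map_add X Y

theorem connectionForm_smul (cov : TangentConnection E M) (x : M) (c : ℝ)
    (X : TangentSpace 𝓘(ℝ, E) x) :
    connectionForm cov x (c • X) = c • connectionForm cov x X := by
  ext Z
  exact (cov (constantExtension x Z) x).map_smul c X

omit [FiniteDimensional ℝ E] in
/-- The covariant derivative `D + [Γ, J]` of a field of endomorphisms with value `J` and
coordinate derivative `D`, for a connection with connection form `Γ`. -/
def endDerivative (D Γ J : E →L[ℝ] E) : E →L[ℝ] E := D + (Γ * J - J * Γ)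

theorem connector_eq (cov : TangentConnection E M) (p : EndBundle E M)
    (v : TangentSpace (EndModel E) p) :
    connector cov p v = endDerivative (E := E)
      (mfderiv (EndModel E) 𝓘(ℝ, E →L[ℝ] E) (endCoord p.1) p v)
      (connectionForm cov p.1 (dproj p v)) p.2 :=
  rfl

theorem connector_add (cov : TangentConnection E M) (p : EndBundle E M)
    (v w : TangentSpace (EndModel E) p) :
    connector cov p (v + w) = connector cov p v + connector cov p w := by
  have h1 := (mfderiv (EndModel E) 𝓘(ℝ, E →L[ℝ] E) (endCoord p.1) p).map_add v w
  have h2 := (dproj p).map_add v w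
  have h3 := connectionForm_add cov p.1 (dproj p v) (dproj p w)
  rw [← h2] at h3
  have key : ∀ D D' Γ Γ' J : E →L[ℝ] E, endDerivative (D + D') (Γ + Γ') J
      = endDerivative D Γ J + endDerivative D' Γ' J := by
    intros; unfold endDerivative; noncomm_ring
  rw [connector_eq, connector_eq, connector_eq]
  refine (congrArg₂ (fun a b : E →L[ℝ] E ↦ endDerivative a b p.2) h1 h3).trans ?_
  exact key ..

theorem connector_smul (cov : TangentConnection E M) (p : EndBundle E M) (c : ℝ)
    (v : TangentSpace (EndModel E) p) :
    connector cov p (c • v) = c • connector cov p v := by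
  have h1 := (mfderiv (EndModel E) 𝓘(ℝ, E →L[ℝ] E) (endCoord p.1) p).map_smul c v
  have h2 := (dproj p).map_smul c v
  have h3 := connectionForm_smul cov p.1 c (dproj p v)
  rw [← h2] at h3
  have key : ∀ D Γ J : E →L[ℝ] E, endDerivative (c • D) (c • Γ) J
      = c • endDerivative D Γ J := by
    intro D Γ J; simp [endDerivative, smul_sub]
  rw [connector_eq, connector_eq]
  refine (congrArg₂ (fun a b : E →L[ℝ] E ↦ endDerivative a b p.2) h1 h3).trans ?_
  exact key ..

/-- This is the splitting into horizontal and vertical parts: the connector differs from the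
derivative of the fibre coordinate by a term that depends only on `dproj`. -/
theorem eq_of_dproj_of_connector (cov : TangentConnection E M) {p : EndBundle E M}
    {v w : TangentSpace (EndModel E) p} (h1 : dproj p v = dproj p w)
    (h2 : connector cov p v = connector cov p w) : v = w := by
  rw [connector_eq, connector_eq, h1] at h2
  have h3 := add_right_cancel (G := E →L[ℝ] E) h2
  rw [← sub_eq_zero]
  apply eq_zero_of_dproj_of_endCoord
  · exact (ContinuousLinearMap.map_sub _ v w).trans (sub_eq_zero.2 h1)
  · exact (ContinuousLinearMap.map_sub _ v w).trans (sub_eq_zero.2 h3)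

/-- The connector along a map into `End(TM)`, in the trivialization at the base point. -/
theorem connector_mfderiv (cov : TangentConnection E M) (f : P → M) (s : ∀ y, EndT E (f y)) {y : P}
    (hs : MDifferentiableAt 𝓘(ℝ, G) (EndModel E) (fun y ↦ (⟨f y, s y⟩ : EndBundle E M)) y) (v : G) :
    connector cov ⟨f y, s y⟩
      (mfderiv 𝓘(ℝ, G) (EndModel E) (fun y ↦ (⟨f y, s y⟩ : EndBundle E M)) y v)
      = endDerivative (E := E)
        (mfderiv 𝓘(ℝ, G) 𝓘(ℝ, E →L[ℝ] E) (fun z ↦ endCoord (f y) ⟨f z, s z⟩) y v)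
        (connectionForm cov (f y) (mfderiv 𝓘(ℝ, G) 𝓘(ℝ, E) f y v)) (s y) := by
  have h1 := mfderiv_comp y (mdifferentiableAt_endCoord (⟨f y, s y⟩ : EndBundle E M)) hs
  have h2 := mfderiv_comp y (mdifferentiableAt_endProj (⟨f y, s y⟩ : EndBundle E M)) hs
  have h1' := congrArg (fun L : G →L[ℝ] (E →L[ℝ] E) ↦ L v) h1
  have h2' := congrArg (fun L : G →L[ℝ] E ↦ L v) h2
  have h3 := congrArg (fun X : E ↦ (connectionForm cov (f y) X : E →L[ℝ] E)) h2'
  exact congrArg₂ (fun a b : E →L[ℝ] E ↦ endDerivative a b (s y)) h1'.symm h3.symm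

omit [FiniteDimensional ℝ E] in
theorem dproj_mfderiv (f : P → M) (s : ∀ y, EndT E (f y)) {y : P}
    (hs : MDifferentiableAt 𝓘(ℝ, G) (EndModel E) (fun y ↦ (⟨f y, s y⟩ : EndBundle E M)) y) (v : G) :
    dproj ⟨f y, s y⟩ (mfderiv 𝓘(ℝ, G) (EndModel E) (fun y ↦ (⟨f y, s y⟩ : EndBundle E M)) y v)
      = mfderiv 𝓘(ℝ, G) 𝓘(ℝ, E) f y v := by
  have h2 := mfderiv_comp y (mdifferentiableAt_endProj (⟨f y, s y⟩ : EndBundle E M)) hs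
  exact (congrArg (fun L : G →L[ℝ] E ↦ L v) h2).symm

omit [FiniteDimensional ℝ E] in
theorem mdifferentiableAt_endBundle_iff (f : P → M) (s : ∀ y, EndT E (f y)) {y : P} :
    MDifferentiableAt 𝓘(ℝ, G) (EndModel E) (fun y ↦ (⟨f y, s y⟩ : EndBundle E M)) y ↔
      MDifferentiableAt 𝓘(ℝ, G) 𝓘(ℝ, E) f y ∧
        MDifferentiableAt 𝓘(ℝ, G) 𝓘(ℝ, E →L[ℝ] E) (fun z ↦ endCoord (f y) ⟨f z, s z⟩) y :=
  mdifferentiableAt_totalSpace 𝓘(ℝ, E) _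

end Connector
end Coordinates

/-! ### Product rule for bilinear expressions on a manifold -/

section ProductRule

variable {G : Type*} [NormedAddCommGroup G] [NormedSpace ℝ G]
  {P : Type*} [TopologicalSpace P] [ChartedSpace G P]
  {A B C : Type*} [NormedAddCommGroup A] [NormedSpace ℝ A] [NormedAddCommGroup B] [NormedSpace ℝ B]
  [NormedAddCommGroup C] [NormedSpace ℝ C]

theorem HasMFDerivAt.of_bilinear (β : A →L[ℝ] B →L[ℝ] C) {f : P → A} {g : P → B} {y : P}
    {f' : G →L[ℝ] A} {g' : G →L[ℝ] B}
    (hf : HasMFDerivAt 𝓘(ℝ, G) 𝓘(ℝ, A) f y f') (hg : HasMFDerivAt 𝓘(ℝ, G) 𝓘(ℝ, B) g y g') :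
    HasMFDerivAt 𝓘(ℝ, G) 𝓘(ℝ, C) (fun z ↦ β (f z) (g z)) y
      (β.precompR G (f y) g' + β.precompL G f' (g y) : G →L[ℝ] C) := by
  refine ⟨β.continuous₂.continuousAt.comp₂ hf.1 hg.1, ?_⟩
  have := β.hasFDerivWithinAt_of_bilinear hf.2 hg.2
  simp only [writtenInExtChartAt, mfld_simps, Function.comp_def] at this ⊢
  exact this

theorem mfderiv_of_bilinear (β : A →L[ℝ] B →L[ℝ] C) {f : P → A} {g : P → B} {y : P}
    (hf : MDifferentiableAt 𝓘(ℝ, G) 𝓘(ℝ, A) f y) (hg : MDifferentiableAt 𝓘(ℝ, G) 𝓘(ℝ, B) g y)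
    (v : G) :
    mfderiv 𝓘(ℝ, G) 𝓘(ℝ, C) (fun z ↦ β (f z) (g z)) y v
      = β (f y) (mfderiv 𝓘(ℝ, G) 𝓘(ℝ, B) g y v) + β (mfderiv 𝓘(ℝ, G) 𝓘(ℝ, A) f y v) (g y) :=
  congrArg (fun L : G →L[ℝ] C ↦ L v) (hf.hasMFDerivAt.of_bilinear β hg.hasMFDerivAt).mfderiv

end ProductRule

/-! ### Algebra of the operator `D + [Γ, J]` -/

section Algebra

variable {E : Type*} [NormedAddCommGroup E] [NormedSpace ℝ E]

/-- The commutator of any `Γ` with `J` anticommutes with `J`, because `J²` is central. -/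
theorem endDerivative_anticommute {D Γ J : E →L[ℝ] E} (hJ : J * J = -1) (h : J * D + D * J = 0) :
    endDerivative D Γ J * J = -(J * endDerivative D Γ J) := by
  have h1 : D * J = -(J * D) := eq_neg_of_add_eq_zero_right h
  simp only [endDerivative, add_mul, mul_add, sub_mul, mul_sub, h1, mul_assoc, hJ]
  simp only [← mul_assoc, hJ]
  noncomm_ring

theorem endDerivative_frame (a b c a' b' c' : ℝ) (I J K DI DJ DK Γ : E →L[ℝ] E) :
    endDerivative ((a • DI + a' • I) + (b • DJ + b' • J) + (c • DK + c' • K)) Γ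
      (a • I + b • J + c • K)
      = (a' • I + b' • J + c' • K) + (a • endDerivative DI Γ I + b • endDerivative DJ Γ J
        + c • endDerivative DK Γ K) := by
  simp only [endDerivative, mul_add, add_mul, smul_mul_assoc, mul_smul_comm]
  module

theorem endDerivative_frame_mem (Q : Submodule ℝ (E →L[ℝ] E)) (a b c a' b' c' : ℝ)
    {i j k I J K DI DJ DK Γ : E →L[ℝ] E} (hi : i = I) (hj : j = J) (hk : k = K)
    (hI : I ∈ Q) (hJ : J ∈ Q) (hK : K ∈ Q) (hDI : endDerivative DI Γ I ∈ Q)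
    (hDJ : endDerivative DJ Γ J ∈ Q) (hDK : endDerivative DK Γ K ∈ Q) :
    endDerivative ((a • DI + a' • i) + (b • DJ + b' • j) + (c • DK + c' • k)) Γ
      (a • i + b • j + c • k) ∈ Q := by
  subst hi hj hk
  rw [endDerivative_frame]
  exact Q.add_mem
    (Q.add_mem (Q.add_mem (Q.smul_mem _ hI) (Q.smul_mem _ hJ)) (Q.smul_mem _ hK))
    (Q.add_mem (Q.add_mem (Q.smul_mem _ hDI) (Q.smul_mem _ hDJ)) (Q.smul_mem _ hDK))

end Algebra

/-! ### Covariant derivatives of sections of `Q` along maps -/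

section Frames

variable {E : Type*} [NormedAddCommGroup E] [NormedSpace ℝ E]
  {M : Type*} [TopologicalSpace M] [ChartedSpace E M] [IsManifold 𝓘(ℝ, E) ∞ M]
  {G : Type*} [NormedAddCommGroup G] [NormedSpace ℝ G]
  {P : Type*} [TopologicalSpace P] [ChartedSpace G P]

theorem AlmostQuaternionicStructure.isQuaternionicSubspace
    (S : AlmostQuaternionicStructure E M) (x : M) :
    IsQuaternionicSubspace (R := E →L[ℝ] E) (S.Q x) := by
  obtain ⟨U, -, hx, I, J, K, -, -, -, h⟩ := S.exists_frame x
  obtain ⟨h1, h2, h3, h4, h5⟩ := h x hx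
  exact ⟨I x, J x, K x, h1, h2, h3, h4, h5⟩

theorem exists_normalized_functional [Nontrivial E] :
    ∃ l : (E →L[ℝ] E) →L[ℝ] ℝ, l 1 = 1 := by
  obtain ⟨v, hv⟩ := exists_ne (0 : E)
  obtain ⟨f, hf⟩ := SeparatingDual.exists_eq_one (R := ℝ) hv
  exact ⟨f ∘L ContinuousLinearMap.apply ℝ E v, by simpa using hf⟩

theorem SmoothEndOn.mdifferentiableAt {s : ∀ x : M, EndT E x} {U : Set M} (hs : SmoothEndOn s U)
    (hU : IsOpen U) {x : M} (hx : x ∈ U) :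
    MDifferentiableAt 𝓘(ℝ, E) (EndModel E) (fun x ↦ (⟨x, s x⟩ : EndBundle E M)) x :=
  (hs.contMDiffAt (hU.mem_nhds hx)).mdifferentiableAt (by simp)

/-- The anticommutator of `u` with a basis element is `-2` times the corresponding coefficient, as a
multiple of `1`; the functional `l` extracts the scalar. The coefficients are thus continuous
bilinear in `u` and the frame, hence differentiable when these are. -/
theorem quaternionic_coefficients [Nontrivial E] {l : (E →L[ℝ] E) →L[ℝ] ℝ} (hl : l 1 = 1)
    {I J K u : E →L[ℝ] E}
    (hI : I * I = -1) (hJ : J * J = -1) (hK : K * K = -1) (hIJK : I * (J * K) = -1)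
    (hu : u ∈ Submodule.span ℝ {I, J, K}) :
    u = ((-1 / 2 : ℝ) * l (u * I + I * u)) • I + ((-1 / 2 : ℝ) * l (u * J + J * u)) • J
      + ((-1 / 2 : ℝ) * l (u * K + K * u)) • K := by
  obtain ⟨a, b, c, rfl⟩ := mem_span_triple_iff.1 hu
  have h1 := quaternionic_anticommutator hI hJ hK hIJK a b c 1 0 0
  have h2 := quaternionic_anticommutator hI hJ hK hIJK a b c 0 1 0
  have h3 := quaternionic_anticommutator hI hJ hK hIJK a b c 0 0 1
  simp only [one_smul, zero_smul, zero_add, add_zero] at h1 h2 h3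
  rw [h1, h2, h3]
  simp only [map_smul, hl, smul_eq_mul]
  congr 1
  · congr 1
    · congr 1; ring
    · congr 1; ring
  · congr 1; ring

variable [FiniteDimensional ℝ E]

/-- The covariant derivative of a section of `Q` along a map is a section of `Q`. -/
theorem IsAlmostQuaternionicConnection.connector_mfderiv_mem [Nontrivial E]
    {S : AlmostQuaternionicStructure E M} {cov : TangentConnection E M}
    (h : IsAlmostQuaternionicConnection S cov) (f : P → M) (s : ∀ y, EndT E (f y)) {y : P}
    (hs : MDifferentiableAt 𝓘(ℝ, G) (EndModel E) (fun y ↦ (⟨f y, s y⟩ : EndBundle E M)) y)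
    (hQ : ∀ᶠ z in 𝓝 y, s z ∈ S.Q (f z)) (v : G) :
    connector cov ⟨f y, s y⟩
      (mfderiv 𝓘(ℝ, G) (EndModel E) (fun y ↦ (⟨f y, s y⟩ : EndBundle E M)) y v) ∈ S.Q (f y) := by
  obtain ⟨U, hU, hxU, I, J, K, hI, hJ, hK, hrel⟩ := S.exists_frame (f y)
  obtain ⟨l, hl⟩ := exists_normalized_functional (E := E)
  have hf : MDifferentiableAt 𝓘(ℝ, G) 𝓘(ℝ, E) f y :=
    ((mdifferentiableAt_endBundle_iff f s).1 hs).1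
  set e := trivializationAt E (TangentSpace 𝓘(ℝ, E) : M → Type _) (f y)
  have hnhds : ∀ᶠ z in 𝓝 y, f z ∈ U ∩ e.baseSet :=
    hf.continuousAt.eventually ((hU.inter e.open_baseSet).mem_nhds
      ⟨hxU, FiberBundle.mem_baseSet_trivializationAt' (f y)⟩)
  -- the covariant derivative of a local section of `Q`
  have hsec : ∀ A : ∀ x : M, EndT E x, SmoothEndOn A U → (∀ x ∈ U, A x ∈ S.Q x) →
      MDifferentiableAt 𝓘(ℝ, G) 𝓘(ℝ, E →L[ℝ] E) (fun z ↦ endCoord (f y) ⟨f z, A (f z)⟩) y ∧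
      endDerivative (E := E)
        (mfderiv 𝓘(ℝ, G) 𝓘(ℝ, E →L[ℝ] E) (fun z ↦ endCoord (f y) ⟨f z, A (f z)⟩) y v)
        (connectionForm cov (f y) (mfderiv 𝓘(ℝ, G) 𝓘(ℝ, E) f y v)) (A (f y)) ∈ S.Q (f y) := by
    intro A hA hAQ
    have hAd := hA.mdifferentiableAt hU hxU
    have hAf : MDifferentiableAt 𝓘(ℝ, G) (EndModel E)
        (fun z ↦ (⟨f z, A (f z)⟩ : EndBundle E M)) y := hAd.comp y hf
    refine ⟨((mdifferentiableAt_endBundle_iff f (fun z ↦ A (f z))).1 hAf).2, ?_⟩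
    rw [← connector_mfderiv cov f (fun z ↦ A (f z)) hAf v]
    -- The hypothesis on the connection concerns smooth sections over open sets of `M`; for the
    -- pullback of such a section by `f` the chain rule suffices. A general section along `f` is
    -- then handled through its frame coefficients.
    have := h.preserves U A hU hA hAQ (f y) hxU (mfderiv 𝓘(ℝ, G) 𝓘(ℝ, E) f y v)
    have hc := congrArg (fun L : G →L[ℝ] (E × (E →L[ℝ] E)) ↦ L v) (mfderiv_comp y hAd hf)
    have hc' := congrArg (fun w : E × (E →L[ℝ] E) ↦
      (connector cov ⟨f y, A (f y)⟩ w : E →L[ℝ] E)) hc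
    have goal : ∀ q : E →L[ℝ] E, q = connector cov ⟨f y, A (f y)⟩
        (mfderiv 𝓘(ℝ, E) (EndModel E) (fun y ↦ (⟨y, A y⟩ : EndBundle E M)) (f y)
          (mfderiv 𝓘(ℝ, G) 𝓘(ℝ, E) f y v)) → q ∈ S.Q (f y) := fun q hq ↦ hq ▸ this
    exact goal _ hc'
  have hQU : ∀ x ∈ U, I x ∈ S.Q x ∧ J x ∈ S.Q x ∧ K x ∈ S.Q x := fun x hx ↦ by
    rw [(hrel x hx).2.2.2.2]
    exact ⟨Submodule.subset_span (by simp), Submodule.subset_span (by simp),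
      Submodule.subset_span (by simp)⟩
  obtain ⟨hId, hIQ⟩ := hsec I hI fun x hx ↦ (hQU x hx).1
  obtain ⟨hJd, hJQ⟩ := hsec J hJ fun x hx ↦ (hQU x hx).2.1
  obtain ⟨hKd, hKQ⟩ := hsec K hK fun x hx ↦ (hQU x hx).2.2
  have hud := ((mdifferentiableAt_endBundle_iff f s).1 hs).2
  -- the coefficients of the section in the frame
  let β : (E →L[ℝ] E) →L[ℝ] (E →L[ℝ] E) →L[ℝ] ℝ := (-1 / 2 : ℝ) •
    (ContinuousLinearMap.compL ℝ (E →L[ℝ] E) (E →L[ℝ] E) ℝ l ∘L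
      (ContinuousLinearMap.mul ℝ (E →L[ℝ] E) + (ContinuousLinearMap.mul ℝ (E →L[ℝ] E)).flip))
  let u : P → E →L[ℝ] E := fun z ↦ endCoord (f y) ⟨f z, s z⟩
  let i : P → E →L[ℝ] E := fun z ↦ endCoord (f y) ⟨f z, I (f z)⟩
  let j : P → E →L[ℝ] E := fun z ↦ endCoord (f y) ⟨f z, J (f z)⟩
  let k : P → E →L[ℝ] E := fun z ↦ endCoord (f y) ⟨f z, K (f z)⟩
  have hexp : u =ᶠ[𝓝 y]
      fun z ↦ β (u z) (i z) • i z + β (u z) (j z) • j z + β (u z) (k z) • k z := by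
    filter_upwards [hnhds, hQ] with z hz hsz
    obtain ⟨h1, h2, h3, h4, h5⟩ := hrel (f z) hz.1
    have hneg := endCoord_neg_id (E := E) hz.2
    have hi : i z * i z = -1 := by rw [← hneg, ← h1, endCoord_comp hz.2]
    have hj : j z * j z = -1 := by rw [← hneg, ← h2, endCoord_comp hz.2]
    have hk : k z * k z = -1 := by rw [← hneg, ← h3, endCoord_comp hz.2]
    have hijk : i z * (j z * k z) = -1 := by
      rw [← hneg, ← h4, endCoord_comp hz.2, endCoord_comp hz.2]
    refine quaternionic_coefficients hl hi hj hk hijk ?_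
    rw [h5] at hsz
    obtain ⟨a, b, c, hs⟩ := mem_span_triple_iff.1 hsz
    exact mem_span_triple_iff.2 ⟨a, b, c, by rw [← endCoord_lincomb, ← hs]⟩
  let σ := ContinuousLinearMap.lsmul ℝ ℝ (E := E →L[ℝ] E)
  -- The number `a'` is the derivative of the coefficient along `v`. Its value is irrelevant, since
  -- it only multiplies a frame element, which lies in `Q`.
  have hterm : ∀ (i : P → E →L[ℝ] E) (D : G →L[ℝ] (E →L[ℝ] E)),
      HasMFDerivAt 𝓘(ℝ, G) 𝓘(ℝ, E →L[ℝ] E) i y D →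
      ∃ a' : ℝ, ∃ L : G →L[ℝ] (E →L[ℝ] E),
        HasMFDerivAt 𝓘(ℝ, G) 𝓘(ℝ, E →L[ℝ] E) (fun z ↦ β (u z) (i z) • i z) y L ∧
        L v = β (u y) (i y) • D v + a' • i y := by
    intro i D hi
    exact ⟨_, _, (hud.hasMFDerivAt.of_bilinear β hi).of_bilinear σ hi, rfl⟩
  obtain ⟨a', LI, hLI, hLI'⟩ := hterm i _ hId.hasMFDerivAt
  obtain ⟨b', LJ, hLJ, hLJ'⟩ := hterm j _ hJd.hasMFDerivAt
  obtain ⟨c', LK, hLK, hLK'⟩ := hterm k _ hKd.hasMFDerivAt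
  have hder : mfderiv 𝓘(ℝ, G) 𝓘(ℝ, E →L[ℝ] E) u y = LI + LJ + LK :=
    (((hLI.add hLJ).add hLK).congr_of_eventuallyEq hexp).mfderiv
  have hder' := congrArg (fun L : G →L[ℝ] (E →L[ℝ] E) ↦ L v) hder
  have hder'' : (LI + LJ + LK) v = LI v + LJ v + LK v := rfl
  rw [hLI', hLJ', hLK'] at hder''
  have hval := hexp.eq_of_nhds
  have hiy : i y = I (f y) := endCoord_self _ _
  have hjy : j y = J (f y) := endCoord_self _ _
  have hky : k y = K (f y) := endCoord_self _ _
  have huy : u y = s y := endCoord_self _ _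
  rw [connector_mfderiv cov f s hs v]
  have hfin : ∀ D Γ q : E →L[ℝ] E, D = (LI + LJ + LK) v → q = u y →
      endDerivative D Γ q = endDerivative ((LI + LJ + LK) v) Γ
        (β (u y) (i y) • i y + β (u y) (j y) • j y + β (u y) (k y) • k y) := by
    rintro D Γ q rfl rfl
    exact congrArg _ hval
  have hmem : ∀ (Q : Submodule ℝ (E →L[ℝ] E)) {p q : E →L[ℝ] E}, p = q → q ∈ Q → p ∈ Q :=
    fun _ _ _ h hq ↦ h ▸ hq
  refine hmem (S.Q (f y)) (hfin _ _ _ hder' huy.symm) ?_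
  rw [hder'']
  exact endDerivative_frame_mem (E := E) (S.Q (f y)) _ _ _ _ _ _ hiy hjy hky (hQU _ hxU).1
    (hQU _ hxU).2.1 (hQU _ hxU).2.2 hIQ hJQ hKQ

end Frames

/-! ### Sections of the twistor space -/

section TwistorSections

variable {E : Type*} [NormedAddCommGroup E] [NormedSpace ℝ E]
  {M : Type*} [TopologicalSpace M] [ChartedSpace E M] [IsManifold 𝓘(ℝ, E) ∞ M]
  {G : Type*} [NormedAddCommGroup G] [NormedSpace ℝ G]
  {P : Type*} [TopologicalSpace P] [ChartedSpace G P]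

/-- Differentiating `s² = -1` in the trivialization gives `sD + Ds = 0`; the commutator with `Γ`
anticommutes with `s` in any case. -/
theorem connector_mfderiv_anticommute [FiniteDimensional ℝ E]
    (cov : TangentConnection E M) (f : P → M) (s : ∀ y, EndT E (f y)) {y : P}
    (hs : MDifferentiableAt 𝓘(ℝ, G) (EndModel E) (fun y ↦ (⟨f y, s y⟩ : EndBundle E M)) y)
    (hsq : ∀ z, s z ∘L s z = -ContinuousLinearMap.id ℝ _) (v : G) :
    connector cov ⟨f y, s y⟩
        (mfderiv 𝓘(ℝ, G) (EndModel E) (fun y ↦ (⟨f y, s y⟩ : EndBundle E M)) y v) ∘L s y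
      = -(s y ∘L connector cov ⟨f y, s y⟩
        (mfderiv 𝓘(ℝ, G) (EndModel E) (fun y ↦ (⟨f y, s y⟩ : EndBundle E M)) y v)) := by
  rw [connector_mfderiv cov f s hs v]
  obtain ⟨hf, hu⟩ := (mdifferentiableAt_endBundle_iff f s).1 hs
  set e := trivializationAt E (TangentSpace 𝓘(ℝ, E) : M → Type _) (f y)
  have hnhds : ∀ᶠ z in 𝓝 y, f z ∈ e.baseSet :=
    hf.continuousAt.eventually (e.open_baseSet.mem_nhds
      (FiberBundle.mem_baseSet_trivializationAt' (f y)))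
  let u : P → E →L[ℝ] E := fun z ↦ endCoord (f y) ⟨f z, s z⟩
  let β := ContinuousLinearMap.mul ℝ (E →L[ℝ] E)
  have hexp : (fun z ↦ β (u z) (u z)) =ᶠ[𝓝 y] fun _ ↦ -1 := by
    filter_upwards [hnhds] with z hz
    change u z * u z = -1
    rw [← endCoord_neg_id (E := E) hz, ← hsq z, endCoord_comp hz]
  have hder := (hexp.mfderiv_eq (I := 𝓘(ℝ, G)) (I' := 𝓘(ℝ, E →L[ℝ] E))).trans mfderiv_const
  have hprod := (mfderiv_of_bilinear β hu hu v).symm.trans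
    (congrArg (fun L : G →L[ℝ] (E →L[ℝ] E) ↦ L v) hder)
  have huy : u y = s y := endCoord_self _ _
  have key : ∀ (D Γ J U : E →L[ℝ] E), U = J → J * J = -1 → β U D + β D U = 0 →
      endDerivative D Γ J * J = -(J * endDerivative D Γ J) := by
    rintro D Γ J U rfl hJ h
    exact endDerivative_anticommute hJ h
  exact key _ _ _ _ huy (hsq y) hprod

/-- The coefficients of `J₀` in a local quaternionic frame are kept constant. -/
theorem exists_twistor_section [Nontrivial E] (S : AlmostQuaternionicStructure E M) (x : M)
    (J₀ : S.Z x) :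
    ∃ (U : Set M) (s : ∀ y : M, S.Z y), IsOpen U ∧ x ∈ U ∧
      SmoothEndOn (fun y ↦ (s y : EndT E y)) U ∧ s x = J₀ := by
  classical
  obtain ⟨U, hU, hxU, I, J, K, hI, hJ, hK, hrel⟩ := S.exists_frame x
  obtain ⟨J₀, hJQ, hJsq⟩ := J₀
  have hJQ' := hJQ
  rw [(hrel x hxU).2.2.2.2] at hJQ'
  obtain ⟨a, b, c, rfl⟩ := Submodule.mem_span_triple.1 hJQ'
  have hsq : ∀ y ∈ U, ∀ q : E →L[ℝ] E, q = a • I y + b • J y + c • K y →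
      q * q = (-(a * a + b * b + c * c)) • (1 : E →L[ℝ] E) := by
    intro y hy q hq
    obtain ⟨h1, h2, h3, h4, -⟩ := hrel y hy
    rw [hq]
    exact quaternionic_sq (R := E →L[ℝ] E) h1 h2 h3 h4 a b c
  have hnorm : a * a + b * b + c * c = 1 := by
    have h1 := (hsq x hxU _ rfl).symm.trans hJsq
    -- The scalar is recovered from `J₀² = -1` by evaluation at a nonzero vector; on the zero space
    -- it would be undetermined.
    obtain ⟨v, hv⟩ := exists_ne (0 : E)
    have h2 : (-(a * a + b * b + c * c)) • v = -v :=
      congrArg (fun L : E →L[ℝ] E ↦ L v) h1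
    have h3 : (1 - (a * a + b * b + c * c)) • v = 0 := by
      rw [sub_smul, one_smul, sub_eq_add_neg, ← neg_smul, h2, add_neg_cancel]
    have := (smul_eq_zero.1 h3).resolve_right hv
    linarith
  have hZ : ∀ y ∈ U, a • I y + b • J y + c • K y ∈ S.Z y := by
    intro y hy
    refine ⟨?_, ?_⟩
    · rw [(hrel y hy).2.2.2.2]
      exact Submodule.mem_span_triple.2 ⟨a, b, c, rfl⟩
    · refine (hsq y hy _ rfl).trans ?_
      rw [hnorm, neg_smul, one_smul]
      rfl
  have hne : ∀ y, (S.Z y).Nonempty := by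
    intro y
    obtain ⟨V, -, hyV, I', J', K', -, -, -, h'⟩ := S.exists_frame y
    obtain ⟨h1, -, -, -, h5⟩ := h' y hyV
    exact ⟨I' y, by rw [h5]; exact Submodule.subset_span (by simp), h1⟩
  -- Outside `U` an arbitrary point of the fibre is taken, with no regularity.
  refine ⟨U, fun y ↦ if hy : y ∈ U then ⟨_, hZ y hy⟩ else ⟨_, (hne y).some_mem⟩, hU, hxU, ?_, ?_⟩
  · have hsm : ContMDiffOn 𝓘(ℝ, E) (EndModel E) ∞
        (fun y ↦ (⟨y, a • I y + b • J y + c • K y⟩ : EndBundle E M)) U :=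
      ((hI.const_smul_section (a := a)).add_section (hJ.const_smul_section (a := b))).add_section
        (hK.const_smul_section (a := c))
    refine hsm.congr fun y hy ↦ ?_
    simp [hy]
  · simp [hxU]

end TwistorSections

/-! ### The linear extension of `Φ` to `Q_M` -/

section LinearExtension

variable {E : Type*} [NormedAddCommGroup E] [NormedSpace ℝ E]
  {M : Type*} [TopologicalSpace M] [ChartedSpace E M] [IsManifold 𝓘(ℝ, E) ∞ M]
  {F : Type*} [NormedAddCommGroup F] [NormedSpace ℝ F]
  {N : Type*} [TopologicalSpace N] [ChartedSpace F N] [IsManifold 𝓘(ℝ, F) ∞ N]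

/-- Composition with `d` is injective on `Q`, so a linear left inverse of it recovers `Ψ J` from `Ψ
J ∘ d = d ∘ J`, and the right-hand side is linear in `J`. -/
theorem exists_linear_extension {Q : Submodule ℝ (F →L[ℝ] F)} (hQ : IsQuaternionicSubspace Q)
    (d : E →L[ℝ] F) (hd : d ≠ 0) {Z : Set (E →L[ℝ] E)} (Ψ : Z → (F →L[ℝ] F))
    (hΨ : ∀ J, Ψ J ∈ Q) (h : ∀ J : Z, d ∘L (J : E →L[ℝ] E) = Ψ J ∘L d) :
    ∃ L : (E →L[ℝ] E) →ₗ[ℝ] (F →L[ℝ] F), ∀ J : Z, L J = Ψ J := by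
  obtain ⟨v, hv⟩ : ∃ v, d v ≠ 0 := by
    by_contra! hc
    exact hd (ContinuousLinearMap.ext hc)
  let g : Q →ₗ[ℝ] (E →L[ℝ] F) :=
    { toFun := fun q ↦ (q : F →L[ℝ] F) ∘L d
      map_add' := fun _ _ ↦ ContinuousLinearMap.add_comp _ _ _
      map_smul' := fun _ _ ↦ ContinuousLinearMap.smul_comp _ _ _ }
  have hg : LinearMap.ker g = ⊥ := by
    refine LinearMap.ker_eq_bot'.2 fun q hq ↦ Subtype.ext ?_
    exact hQ.eq_zero_of_apply q.2 hv (congrArg (fun L : E →L[ℝ] F ↦ L v) hq)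
  obtain ⟨r, hr⟩ := g.exists_leftInverse_of_injective hg
  let k : (E →L[ℝ] E) →ₗ[ℝ] (E →L[ℝ] F) :=
    { toFun := fun q ↦ d ∘L q
      map_add' := fun _ _ ↦ ContinuousLinearMap.comp_add _ _ _
      map_smul' := fun _ _ ↦ ContinuousLinearMap.comp_smul _ _ _ }
  refine ⟨Q.subtype ∘ₗ r ∘ₗ k, fun J ↦ ?_⟩
  have h1 : k J = g ⟨Ψ J, hΨ J⟩ := h J
  have h2 := LinearMap.congr_fun hr ⟨Ψ J, hΨ J⟩
  simp only [LinearMap.comp_apply, h1] at h2 ⊢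
  rw [h2]
  rfl

variable {S : AlmostQuaternionicStructure E M} {T : AlmostQuaternionicStructure F N} {φ : M → N}
  {Φ : TwistorLift S T φ} (hquat : IsQuaternionicMap Φ)
  {x : M} (hx : mfderiv 𝓘(ℝ, E) 𝓘(ℝ, F) φ x ≠ 0)

include hquat hx

theorem TwistorLift.linearExtension_apply (J : S.Z x) :
    Φ.linearExtension x J = (Φ x J : EndT F (φ x)) := by
  have h : ∃ L : EndT E x →ₗ[ℝ] EndT F (φ x), ∀ J : S.Z x, L J = (Φ x J : EndT F (φ x)) :=
    exists_linear_extension (E := E) (F := F) (T.isQuaternionicSubspace (φ x))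
      (mfderiv 𝓘(ℝ, E) 𝓘(ℝ, F) φ x) hx (Z := S.Z x) (fun J ↦ (Φ x J : EndT F (φ x)))
      (fun J ↦ (Φ x J).2.1) (fun J ↦ hquat x J)
  rw [TwistorLift.linearExtension, dif_pos h]
  exact h.choose_spec J

theorem TwistorLift.linearExtension_spec {B : EndT E x} (hB : B ∈ S.Q x) :
    Φ.linearExtension x B ∈ T.Q (φ x) ∧
      mfderiv 𝓘(ℝ, E) 𝓘(ℝ, F) φ x ∘L B = Φ.linearExtension x B ∘L mfderiv 𝓘(ℝ, E) 𝓘(ℝ, F) φ x := by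
  have hunits : ∀ J : E →L[ℝ] E, J ∈ S.Q x → J * J = -1 →
      Φ.linearExtension x J ∈ T.Q (φ x) ∧
      mfderiv 𝓘(ℝ, E) 𝓘(ℝ, F) φ x ∘L (J : EndT E x)
        = Φ.linearExtension x J ∘L mfderiv 𝓘(ℝ, E) 𝓘(ℝ, F) φ x := by
    intro J hJ hJ2
    rw [TwistorLift.linearExtension_apply hquat hx ⟨J, hJ, hJ2⟩]
    exact ⟨(Φ x ⟨J, hJ, hJ2⟩).2.1, hquat x ⟨J, hJ, hJ2⟩⟩
  have := (S.isQuaternionicSubspace x).intertwining_of_units (V := E) (W := F) (Q' := T.Q (φ x))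
    (d := mfderiv 𝓘(ℝ, E) 𝓘(ℝ, F) φ x) (L := Φ.linearExtension x) hunits hB
  exact this

theorem TwistorLift.linearExtension_mul (J : S.Z x) {B : EndT E x} (hB : B ∈ S.Q x)
    (h : B ∘L (J : EndT E x) = -((J : EndT E x) ∘L B)) :
    Φ.linearExtension x B ∘L (Φ x J : EndT F (φ x))
        = -((Φ x J : EndT F (φ x)) ∘L Φ.linearExtension x B) ∧
      Φ.linearExtension x ((J : EndT E x) ∘L B)
        = (Φ x J : EndT F (φ x)) ∘L Φ.linearExtension x B := by
  rw [← TwistorLift.linearExtension_apply hquat hx J]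
  have := (S.isQuaternionicSubspace x).intertwining_mul (V := E) (W := F)
    (T.isQuaternionicSubspace (φ x)) (d := mfderiv 𝓘(ℝ, E) 𝓘(ℝ, F) φ x) hx
    (L := Φ.linearExtension x) (fun B hB ↦ TwistorLift.linearExtension_spec hquat hx hB)
    J.2.1 hB h
  exact this

end LinearExtension

/-! ### Great circles in the fibres of the twistor space -/

section Circle

theorem circle_sq {R : Type*} [Ring R] [Algebra ℝ R] {J B : R} (hJ : J * J = -1) (hB : B * B = -1)
    (h : B * J = -(J * B)) (t : ℝ) :
    (Real.cos t • J + Real.sin t • B) * (Real.cos t • J + Real.sin t • B) = -1 := by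
  have h1 : (Real.cos t * Real.cos t + Real.sin t * Real.sin t) • (1 : R) = 1 := by
    rw [← sq, ← sq, Real.cos_sq_add_sin_sq, one_smul]
  have h2 : (Real.cos t • J + Real.sin t • B) * (Real.cos t • J + Real.sin t • B)
      = -((Real.cos t * Real.cos t + Real.sin t * Real.sin t) • (1 : R)) := by
    simp only [mul_add, add_mul, smul_mul_smul_comm, hJ, hB, h]
    module
  rw [h2, h1]

theorem hasDerivAt_circle {V : Type*} [NormedAddCommGroup V] [NormedSpace ℝ V] (J B : V) :
    HasDerivAt (fun t : ℝ ↦ Real.cos t • J + Real.sin t • B) B 0 := by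
  have := ((Real.hasDerivAt_cos 0).smul_const J).fun_add ((Real.hasDerivAt_sin 0).smul_const B)
  simpa using this

end Circle

/-! ### The differential of `Φ` on vertical vectors -/

section TwistorDifferential

variable {E : Type*} [NormedAddCommGroup E] [NormedSpace ℝ E]
  {M : Type*} [TopologicalSpace M] [ChartedSpace E M] [IsManifold 𝓘(ℝ, E) ∞ M]
  {F : Type*} [NormedAddCommGroup F] [NormedSpace ℝ F]
  {N : Type*} [TopologicalSpace N] [ChartedSpace F N] [IsManifold 𝓘(ℝ, F) ∞ N]
  {G : Type*} [NormedAddCommGroup G] [NormedSpace ℝ G]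
  {P : Type*} [TopologicalSpace P] [ChartedSpace G P]
  {S : AlmostQuaternionicStructure E M} {T : AlmostQuaternionicStructure F N} {φ : M → N}

theorem TwistorLift.toMap_mk (Φ : TwistorLift S T φ) (x : M) (J : S.Z x) :
    Φ.toMap ⟨x, J⟩ = ⟨φ x, Φ x J⟩ :=
  dif_pos J.2

/-- The differential of `Φ` along `Z_M`, at the point `J` of the fibre over `x`. -/
def TwistorLift.tangentMap (Φ : TwistorLift S T φ) (x : M) (J : S.Z x) :
    TangentSpace (EndModel E) (⟨x, J⟩ : EndBundle E M) →L[ℝ]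
      TangentSpace (EndModel F) (⟨φ x, Φ x J⟩ : EndBundle F N) :=
  mfderivWithin (EndModel E) (EndModel F) Φ.toMap S.twistorSpace ⟨x, J⟩

/-- The derivative of `Φ` within `Z_M` is a linear map on the whole tangent space of `End(TM)`, and
need not be determined transversally to `Z_M`. Along maps with values in `Z_M` the chain rule fixes
its values. -/
theorem TwistorLift.IsSmooth.comp_curve {Φ : TwistorLift S T φ} (hΦ : Φ.IsSmooth) (f : P → M)
    (c : ∀ y, S.Z (f y)) {y : P}
    (hc : MDifferentiableAt 𝓘(ℝ, G) (EndModel E) (fun y ↦ (⟨f y, c y⟩ : EndBundle E M)) y) :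
    MDifferentiableAt 𝓘(ℝ, G) (EndModel F)
        (fun y ↦ (⟨φ (f y), Φ (f y) (c y)⟩ : EndBundle F N)) y ∧
      ∀ v : G, Φ.tangentMap (f y) (c y)
          (mfderiv 𝓘(ℝ, G) (EndModel E) (fun y ↦ (⟨f y, c y⟩ : EndBundle E M)) y v)
        = mfderiv 𝓘(ℝ, G) (EndModel F)
            (fun y ↦ (⟨φ (f y), Φ (f y) (c y)⟩ : EndBundle F N)) y v := by
  have hmem : ∀ z, (⟨f z, c z⟩ : EndBundle E M) ∈ S.twistorSpace := fun z ↦ (c z).2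
  have hd : MDifferentiableWithinAt (EndModel E) (EndModel F) Φ.toMap S.twistorSpace
      (⟨f y, c y⟩ : EndBundle E M) :=
    (hΦ _ (hmem y)).mdifferentiableWithinAt (by simp)
  have hcomp : (fun y ↦ (⟨φ (f y), Φ (f y) (c y)⟩ : EndBundle F N))
      = Φ.toMap ∘ fun y ↦ (⟨f y, c y⟩ : EndBundle E M) := by
    funext z
    exact (Φ.toMap_mk _ _).symm
  have h := (hd.hasMFDerivWithinAt.comp (s := univ) y hc.hasMFDerivAt.hasMFDerivWithinAt
    (u := S.twistorSpace) (fun z _ ↦ hmem z))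
  rw [hasMFDerivWithinAt_univ] at h
  refine ⟨by rw [hcomp]; exact h.mdifferentiableAt, fun v ↦ ?_⟩
  have h2 := h.mfderiv
  rw [← hcomp] at h2
  exact (congrArg (fun L : G →L[ℝ] (F × (F →L[ℝ] F)) ↦ L v) h2).symm

variable [FiniteDimensional ℝ E]

theorem vertical_curve (cov : TangentConnection E M) (x : M) (c : ℝ → EndT E x) {B : E →L[ℝ] E}
    (hc : HasDerivAt (F := E →L[ℝ] E) c B 0) :
    MDifferentiableAt 𝓘(ℝ, ℝ) (EndModel E) (fun t ↦ (⟨x, c t⟩ : EndBundle E M)) 0 ∧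
    dproj ⟨x, c 0⟩ (mfderiv 𝓘(ℝ, ℝ) (EndModel E) (fun t ↦ (⟨x, c t⟩ : EndBundle E M)) 0 (1 : ℝ))
      = 0 ∧
    connector cov ⟨x, c 0⟩
      (mfderiv 𝓘(ℝ, ℝ) (EndModel E) (fun t ↦ (⟨x, c t⟩ : EndBundle E M)) 0 (1 : ℝ)) = B := by
  have heq : (fun t ↦ endCoord x ⟨x, c t⟩) = c := funext fun t ↦ endCoord_self x (c t)
  have hcd : HasMFDerivAt 𝓘(ℝ, ℝ) 𝓘(ℝ, E →L[ℝ] E) (fun t : ℝ ↦ endCoord x ⟨x, c t⟩) 0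
      (ContinuousLinearMap.toSpanSingleton ℝ B : ℝ →L[ℝ] (E →L[ℝ] E)) := by
    rw [heq]
    exact hc.hasFDerivAt.hasMFDerivAt
  have hd : MDifferentiableAt 𝓘(ℝ, ℝ) (EndModel E) (fun t ↦ (⟨x, c t⟩ : EndBundle E M)) 0 :=
    (mdifferentiableAt_endBundle_iff (fun _ : ℝ ↦ x) c).2
      ⟨mdifferentiableAt_const, hcd.mdifferentiableAt⟩
  have h0 : mfderiv 𝓘(ℝ, ℝ) 𝓘(ℝ, E) (fun _ : ℝ ↦ x) 0 (1 : ℝ) = 0 :=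
    congrArg (fun L : ℝ →L[ℝ] E ↦ L 1) (mfderiv_const (I := 𝓘(ℝ, ℝ)) (I' := 𝓘(ℝ, E)))
  refine ⟨hd, (dproj_mfderiv (fun _ : ℝ ↦ x) c hd (1 : ℝ)).trans h0, ?_⟩
  rw [connector_mfderiv cov (fun _ : ℝ ↦ x) c hd (1 : ℝ)]
  have hΓ : connectionForm cov x (mfderiv 𝓘(ℝ, ℝ) 𝓘(ℝ, E) (fun _ : ℝ ↦ x) 0 (1 : ℝ)) = 0 := by
    rw [h0]
    have := connectionForm_smul cov x 0 (0 : E)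
    rw [zero_smul] at this
    refine Eq.trans ?_ this
    exact congrArg _ (zero_smul ℝ (0 : E)).symm
  have hD : mfderiv 𝓘(ℝ, ℝ) 𝓘(ℝ, E →L[ℝ] E) (fun t : ℝ ↦ endCoord x ⟨x, c t⟩) 0 (1 : ℝ) = B := by
    refine (congrArg (fun L : ℝ →L[ℝ] (E →L[ℝ] E) ↦ L 1) hcd.mfderiv).trans ?_
    exact one_smul ℝ B
  have key : ∀ (D Γ J : E →L[ℝ] E), D = B → Γ = 0 → endDerivative D Γ J = B := by
    rintro D Γ J rfl rfl
    simp [endDerivative]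
  exact key _ _ _ hD hΓ

variable [FiniteDimensional ℝ F]

/-- Vertical vectors tangent to `Z_M`, and their images under `Φ`. -/
theorem TwistorLift.exists_vertical {Φ : TwistorLift S T φ} (hΦ : Φ.IsSmooth)
    (hquat : IsQuaternionicMap Φ) (covM : TangentConnection E M) (covN : TangentConnection F N)
    {x : M} (hx : mfderiv 𝓘(ℝ, E) 𝓘(ℝ, F) φ x ≠ 0) (J : S.Z x) {B : EndT E x} (hB : B ∈ S.Q x)
    (hBJ : B ∘L (J : EndT E x) = -((J : EndT E x) ∘L B)) :
    ∃ w : TangentSpace (EndModel E) (⟨x, J⟩ : EndBundle E M),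
      dproj ⟨x, J⟩ w = 0 ∧ connector covM ⟨x, J⟩ w = B ∧
      dproj ⟨φ x, Φ x J⟩ (Φ.tangentMap x J w) = 0 ∧
      connector covN ⟨φ x, Φ x J⟩ (Φ.tangentMap x J w) = Φ.linearExtension x B := by
  -- the case where `B` is itself a complex structure
  have hunit : ∀ B : EndT E x, B ∈ S.Q x → B ∘L B = -ContinuousLinearMap.id ℝ _ →
      B ∘L (J : EndT E x) = -((J : EndT E x) ∘L B) →
      ∃ w : TangentSpace (EndModel E) (⟨x, J⟩ : EndBundle E M),
        dproj ⟨x, J⟩ w = 0 ∧ connector covM ⟨x, J⟩ w = B ∧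
        dproj ⟨φ x, Φ x J⟩ (Φ.tangentMap x J w) = 0 ∧
        connector covN ⟨φ x, Φ x J⟩ (Φ.tangentMap x J w) = Φ.linearExtension x B := by
    intro B hB hB2 hBJ
    -- The great circle through `J` with velocity `B` stays in the fibre of `Z_M`, and linearity of
    -- `Φ` on the fibre sends it to the great circle through `Φ(J)` with velocity `L B`.
    obtain ⟨c, hc0, hc⟩ : ∃ c : ℝ → S.Z x, c 0 = J ∧
        ∀ t, (c t).1 = Real.cos t • J.1 + Real.sin t • B :=
      ⟨fun t ↦ ⟨Real.cos t • (J : EndT E x) + Real.sin t • B,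
        (S.Q x).add_mem ((S.Q x).smul_mem _ J.2.1) ((S.Q x).smul_mem _ hB),
        circle_sq (R := E →L[ℝ] E) J.2.2 hB2 hBJ t⟩, Subtype.ext (by simp), fun t ↦ rfl⟩
    subst hc0
    have hd : HasDerivAt (F := E →L[ℝ] E) (fun t ↦ (c t).1) B 0 := by
      rw [funext hc]
      exact hasDerivAt_circle _ _
    have hcN : ∀ t, (Φ x (c t)).1 = Real.cos t • (Φ x (c 0)).1
        + Real.sin t • (Φ.linearExtension x B : F →L[ℝ] F) := by
      intro t
      have h1 := TwistorLift.linearExtension_apply hquat hx (c t)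
      have h2 := TwistorLift.linearExtension_apply hquat hx (c 0)
      have h3 : (c t : EndT E x) = Real.cos t • (c 0 : EndT E x) + Real.sin t • B := hc t
      rw [h3, map_add, map_smul, map_smul, h2] at h1
      exact h1.symm
    have hdN : HasDerivAt (F := F →L[ℝ] F) (fun t ↦ (Φ x (c t)).1)
        (Φ.linearExtension x B) 0 := by
      rw [funext hcN]
      exact hasDerivAt_circle _ _
    obtain ⟨h1, h2, h3⟩ := vertical_curve covM x (fun t ↦ (c t : EndT E x)) hd
    obtain ⟨-, h2', h3'⟩ := vertical_curve covN (φ x) (fun t ↦ (Φ x (c t) : EndT F (φ x))) hdN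
    have h4 := (hΦ.comp_curve (fun _ : ℝ ↦ x) c h1).2 (1 : ℝ)
    refine ⟨_, h2, h3, ?_, ?_⟩
    · exact (congrArg _ h4).trans h2'
    · exact (congrArg _ h4).trans h3'
  by_cases hB0 : B = 0
  · subst hB0
    refine ⟨0, ContinuousLinearMap.map_zero _, ?_, ?_, ?_⟩
    · have := connector_smul covM ⟨x, J⟩ 0 0
      simpa using this
    · rw [ContinuousLinearMap.map_zero]
      exact ContinuousLinearMap.map_zero _
    · have := connector_smul covN ⟨φ x, Φ x J⟩ 0 0
      rw [ContinuousLinearMap.map_zero, map_zero]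
      simpa using this
  -- All four conditions are homogeneous, so a nonzero `B` may be rescaled to a complex structure.
  · obtain ⟨r, u, hu, hu2, rfl⟩ := (S.isQuaternionicSubspace x).exists_unit_mul hB hB0
    have hr : r ≠ 0 := by
      rintro rfl
      exact hB0 (zero_smul ℝ u)
    have huJ : ∀ u J : E →L[ℝ] E, (r • u) * J = -(J * (r • u)) → u * J = -(J * u) := by
      intro u J h
      rw [smul_mul_assoc, mul_smul_comm, ← smul_neg] at h
      exact smul_right_injective _ hr h
    obtain ⟨w, h1, h2, h3, h4⟩ := hunit u hu hu2 (huJ u J.1 hBJ)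
    refine ⟨r • w, ?_, ?_, ?_, ?_⟩
    · rw [ContinuousLinearMap.map_smul, h1, smul_zero]
    · rw [connector_smul, h2]
      rfl
    · rw [ContinuousLinearMap.map_smul, ContinuousLinearMap.map_smul, h3, smul_zero]
    · rw [ContinuousLinearMap.map_smul, connector_smul, h4]
      exact ((Φ.linearExtension x).map_smul r u).symm

end TwistorDifferential

/-! ### The connection difference, the differential of `Φ` and the Hessian of `φ` -/

section ConnectionDifference

variable {E : Type*} [NormedAddCommGroup E] [NormedSpace ℝ E]
  {M : Type*} [TopologicalSpace M] [ChartedSpace E M] [IsManifold 𝓘(ℝ, E) ∞ M]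
  {F : Type*} [NormedAddCommGroup F] [NormedSpace ℝ F]
  {N : Type*} [TopologicalSpace N] [ChartedSpace F N] [IsManifold 𝓘(ℝ, F) ∞ N]
  {S : AlmostQuaternionicStructure E M} {T : AlmostQuaternionicStructure F N} {φ : M → N}

omit [IsManifold 𝓘(ℝ, E) ∞ M] [IsManifold 𝓘(ℝ, F) ∞ N] in
theorem nontrivial_of_mfderiv_ne_zero {x : M} (hx : mfderiv 𝓘(ℝ, E) 𝓘(ℝ, F) φ x ≠ 0) :
    Nontrivial E ∧ Nontrivial F := by
  constructor
  · by_contra h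
    rw [not_nontrivial_iff_subsingleton] at h
    exact hx (ContinuousLinearMap.ext fun v : E ↦ by
      rw [Subsingleton.elim v 0]
      exact ContinuousLinearMap.map_zero _)
  · by_contra h
    rw [not_nontrivial_iff_subsingleton] at h
    exact hx (ContinuousLinearMap.ext fun v : E ↦ Subsingleton.elim (α := F) _ _)

variable [FiniteDimensional ℝ E] [FiniteDimensional ℝ F]

/-- The data of a local smooth section of `Z_M` and of a quaternionic map which are used to compute
the connection difference at `x`. -/
structure LocalTwistorSection (covM : TangentConnection E M) (covN : TangentConnection F N)
    (Φ : TwistorLift S T φ) (s : ∀ x : M, S.Z x) (x : M) : Prop where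
  hM : IsAlmostQuaternionicConnection S covM
  hN : IsAlmostQuaternionicConnection T covN
  contMDiff : ContMDiff 𝓘(ℝ, E) 𝓘(ℝ, F) ∞ φ
  rank : mfderiv 𝓘(ℝ, E) 𝓘(ℝ, F) φ x ≠ 0
  smooth : Φ.IsSmooth
  quaternionic : IsQuaternionicMap Φ
  differentiable : MDifferentiableAt 𝓘(ℝ, E) (EndModel E)
    (fun y ↦ (⟨y, s y⟩ : EndBundle E M)) x

namespace LocalTwistorSection

variable {covM : TangentConnection E M} {covN : TangentConnection F N}
  {Φ : TwistorLift S T φ} {s : ∀ x : M, S.Z x} {x : M}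
  (h : LocalTwistorSection covM covN Φ s x)

include h

theorem dproj_section (X : TangentSpace 𝓘(ℝ, E) x) :
    dproj ⟨x, s x⟩ (mfderiv 𝓘(ℝ, E) (EndModel E) (fun y ↦ (⟨y, s y⟩ : EndBundle E M)) x X) = X := by
  refine (dproj_mfderiv (fun y : M ↦ y) (fun y ↦ (s y : EndT E y)) h.differentiable X).trans ?_
  exact congrArg (fun L : E →L[ℝ] E ↦ L X) (mfderiv_id (I := 𝓘(ℝ, E)))

theorem dproj_image (X : TangentSpace 𝓘(ℝ, E) x) :
    dproj ⟨φ x, Φ x (s x)⟩ (mfderiv 𝓘(ℝ, E) (EndModel F)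
      (fun y ↦ (⟨φ y, Φ y (s y)⟩ : EndBundle F N)) x X) = mfderiv 𝓘(ℝ, E) 𝓘(ℝ, F) φ x X :=
  dproj_mfderiv φ (fun y ↦ (Φ y (s y) : EndT F (φ y)))
    (h.smooth.comp_curve (fun y : M ↦ y) s h.differentiable).1 X

theorem section_mem (X : TangentSpace 𝓘(ℝ, E) x) :
    mfderiv 𝓘(ℝ, E) (EndModel E) (fun y ↦ (⟨y, s y⟩ : EndBundle E M)) x X
      ∈ twistorTangent S covM ⟨x, s x⟩ := by
  have := (nontrivial_of_mfderiv_ne_zero h.rank).1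
  exact ⟨h.hM.connector_mfderiv_mem (fun y : M ↦ y) (fun y ↦ (s y : EndT E y)) h.differentiable
    (Filter.Eventually.of_forall fun z ↦ (s z).2.1) X,
    connector_mfderiv_anticommute covM (fun y : M ↦ y) (fun y ↦ (s y : EndT E y)) h.differentiable
      (fun z ↦ (s z).2.2) X⟩

theorem image_mem (X : TangentSpace 𝓘(ℝ, E) x) :
    mfderiv 𝓘(ℝ, E) (EndModel F) (fun y ↦ (⟨φ y, Φ y (s y)⟩ : EndBundle F N)) x X
      ∈ twistorTangent T covN ⟨φ x, Φ x (s x)⟩ := by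
  have := (nontrivial_of_mfderiv_ne_zero h.rank).2
  have hd := (h.smooth.comp_curve (fun y : M ↦ y) s h.differentiable).1
  exact ⟨h.hN.connector_mfderiv_mem φ (fun y ↦ (Φ y (s y) : EndT F (φ y))) hd
    (Filter.Eventually.of_forall fun z ↦ (Φ z (s z)).2.1) X,
    connector_mfderiv_anticommute covN φ (fun y ↦ (Φ y (s y) : EndT F (φ y))) hd
      (fun z ↦ (Φ z (s z)).2.2) X⟩

theorem connectionDifference_mem (X : TangentSpace 𝓘(ℝ, E) x) :
    connectionDifference covM covN Φ s x X ∈ T.Q (φ x) ∧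
    connectionDifference covM covN Φ s x X ∘L (Φ x (s x) : EndT F (φ x))
      = -((Φ x (s x) : EndT F (φ x)) ∘L connectionDifference covM covN Φ s x X) := by
  obtain ⟨h1, h2⟩ := h.section_mem X
  obtain ⟨h3, h4⟩ := h.image_mem X
  have h5 := (TwistorLift.linearExtension_spec h.quaternionic h.rank h1).1
  have h6 := (TwistorLift.linearExtension_mul h.quaternionic h.rank (s x) h1 h2).1
  refine ⟨(T.Q (φ x)).sub_mem h3 h5, ?_⟩
  exact sub_anticommute (R := F →L[ℝ] F) h4 h6

omit h in
theorem connectionDifference_neg (X : TangentSpace 𝓘(ℝ, E) x) :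
    connectionDifference covM covN Φ s x (-X) = -connectionDifference covM covN Φ s x X := by
  have h1 := (mfderiv 𝓘(ℝ, E) (EndModel E) (fun y ↦ (⟨y, s y⟩ : EndBundle E M)) x).map_smul
    (-1 : ℝ) X
  have h2 := (mfderiv 𝓘(ℝ, E) (EndModel F)
    (fun y ↦ (⟨φ y, Φ y (s y)⟩ : EndBundle F N)) x).map_smul (-1 : ℝ) X
  have h3 := (congrArg (connector covM ⟨x, s x⟩) h1).trans (connector_smul ..)
  have h4 := (congrArg (connector covN ⟨φ x, Φ x (s x)⟩) h2).trans (connector_smul ..)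
  rw [neg_one_smul, neg_one_smul] at h3 h4
  unfold connectionDifference
  refine (congrArg₂ (fun a b ↦ a - Φ.linearExtension x b) h4 h3).trans ?_
  rw [map_neg]
  abel

/-- The differential of `Φ` on the vectors tangent to `Z_M`. -/
theorem tangentMap_apply {v : TangentSpace (EndModel E) (⟨x, s x⟩ : EndBundle E M)}
    (hv : v ∈ twistorTangent S covM ⟨x, s x⟩) :
    dproj ⟨φ x, Φ x (s x)⟩ (Φ.tangentMap x (s x) v)
        = mfderiv 𝓘(ℝ, E) 𝓘(ℝ, F) φ x (dproj ⟨x, s x⟩ v) ∧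
      connector covN ⟨φ x, Φ x (s x)⟩ (Φ.tangentMap x (s x) v)
        = Φ.linearExtension x (connector covM ⟨x, s x⟩ v)
          + connectionDifference covM covN Φ s x (dproj ⟨x, s x⟩ v) := by
  obtain ⟨hv1, hv2⟩ := hv
  set X : TangentSpace 𝓘(ℝ, E) x := dproj ⟨x, s x⟩ v with hX
  set B : EndT E x := connector covM ⟨x, s x⟩ v with hB
  obtain ⟨h1, h2⟩ := h.section_mem X
  set u := mfderiv 𝓘(ℝ, E) (EndModel E) (fun y ↦ (⟨y, s y⟩ : EndBundle E M)) x X with hu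
  set C : EndT E x := connector covM ⟨x, s x⟩ u with hC
  -- The vertical vector `w` corrects `u = ds(X)` to `v`: both `v` and `u` lie over `X`, and their
  -- connectors differ by `B - C`, which is tangent to the fibre.
  obtain ⟨w, hw1, hw2, hw3, hw4⟩ := TwistorLift.exists_vertical h.smooth h.quaternionic covM covN
    h.rank (s x) ((S.Q x).sub_mem hv1 h1) (sub_anticommute (R := E →L[ℝ] E) hv2 h2)
  have hvw : v = u + w := by
    apply eq_of_dproj_of_connector covM
    · refine Eq.trans ?_ (ContinuousLinearMap.map_add _ u w).symm
      rw [hw1, h.dproj_section X]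
      exact (add_zero _).symm
    · rw [connector_add, hw2]
      exact (add_sub_cancel C B).symm
  have himg : Φ.tangentMap x (s x) u = mfderiv 𝓘(ℝ, E) (EndModel F)
      (fun y ↦ (⟨φ y, Φ y (s y)⟩ : EndBundle F N)) x X :=
    (h.smooth.comp_curve (fun y : M ↦ y) s h.differentiable).2 X
  have hsum : Φ.tangentMap x (s x) v = Φ.tangentMap x (s x) u + Φ.tangentMap x (s x) w := by
    rw [hvw]
    exact ContinuousLinearMap.map_add _ u w
  constructor
  · rw [hsum]
    refine (ContinuousLinearMap.map_add _ _ _).trans ?_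
    rw [hw3, himg, h.dproj_image X]
    exact add_zero _
  · rw [hsum, connector_add, hw4, himg, map_sub]
    unfold connectionDifference
    abel

-- The passage from coordinate to covariant derivatives: by `d ∘ J = W ∘ d`, the connection forms in
-- the Hessian combine into the commutators with `J` and `W`.
omit h [FiniteDimensional ℝ E] [FiniteDimensional ℝ F] in
theorem hessian_algebra {D d : E →L[ℝ] F} {u ΓM J : E →L[ℝ] E} {w ΓN W : F →L[ℝ] F}
    (hd : d ∘L J = W ∘L d) (hD : d ∘L u + D ∘L J = W ∘L D + w ∘L d) (Y : E) :
    D (J Y) + ΓN (d (J Y)) - d (ΓM (J Y))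
      = W (D Y + ΓN (d Y) - d (ΓM Y))
        + (endDerivative w ΓN W (d Y) - d (endDerivative u ΓM J Y)) := by
  have h1 : ∀ Z, d (J Z) = W (d Z) := fun Z ↦ congrArg (fun f : E →L[ℝ] F ↦ f Z) hd
  have h2 : D (J Y) = W (D Y) + w (d Y) - d (u Y) :=
    eq_sub_of_add_eq' (congrArg (fun f : E →L[ℝ] F ↦ f Y) hD)
  simp only [endDerivative, add_apply, sub_apply, mul_apply_eq_comp, map_add, map_sub, h1, h2]
  abel

/-- The product rule applied to `dφ ∘ s = Φ(s) ∘ dφ`, read in the trivializations at `x` and `φ x`,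
which are the identity on the fibres over these points. -/
theorem coordinate_derivative (X : E) :
    let d : E →L[ℝ] F := mfderiv 𝓘(ℝ, E) 𝓘(ℝ, F) φ x
    let D : E →L[ℝ] F := mfderiv 𝓘(ℝ, E) 𝓘(ℝ, E →L[ℝ] F) (inTangentCoordinates 𝓘(ℝ, E) 𝓘(ℝ, F) id φ
      (fun y ↦ mfderiv 𝓘(ℝ, E) 𝓘(ℝ, F) φ y) x) x X
    let u : E →L[ℝ] E := mfderiv 𝓘(ℝ, E) 𝓘(ℝ, E →L[ℝ] E) (fun z ↦ endCoord x ⟨z, (s z).1⟩) x X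
    let w : F →L[ℝ] F :=
      mfderiv 𝓘(ℝ, E) 𝓘(ℝ, F →L[ℝ] F) (fun z ↦ endCoord (φ x) ⟨φ z, (Φ z (s z)).1⟩) x X
    let J : E →L[ℝ] E := (s x).1
    let W : F →L[ℝ] F := (Φ x (s x)).1
    d ∘L u + D ∘L J = W ∘L D + w ∘L d := by
  let D : M → E →L[ℝ] F := inTangentCoordinates 𝓘(ℝ, E) 𝓘(ℝ, F) id φ
    (fun y ↦ mfderiv 𝓘(ℝ, E) 𝓘(ℝ, F) φ y) x
  let u : M → E →L[ℝ] E := fun z ↦ endCoord x ⟨z, s z⟩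
  let w : M → F →L[ℝ] F := fun z ↦ endCoord (φ x) ⟨φ z, Φ z (s z)⟩
  let eM := trivializationAt E (TangentSpace 𝓘(ℝ, E) : M → Type _) x
  let eN := trivializationAt F (TangentSpace 𝓘(ℝ, F) : N → Type _) (φ x)
  have hDd : MDifferentiableAt 𝓘(ℝ, E) 𝓘(ℝ, E →L[ℝ] F) D x :=
    (h.contMDiff.contMDiffAt.mfderiv_const (m := 1) (by norm_cast)).mdifferentiableAt (by simp)
  have hud : MDifferentiableAt 𝓘(ℝ, E) 𝓘(ℝ, E →L[ℝ] E) u x :=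
    ((mdifferentiableAt_endBundle_iff (fun y : M ↦ y) (fun y ↦ (s y : EndT E y))).1
      h.differentiable).2
  have hwd : MDifferentiableAt 𝓘(ℝ, E) 𝓘(ℝ, F →L[ℝ] F) w x :=
    ((mdifferentiableAt_endBundle_iff φ (fun y ↦ (Φ y (s y) : EndT F (φ y)))).1
      (h.smooth.comp_curve (fun y : M ↦ y) s h.differentiable).1).2
  have hD : ∀ z, D z = ContinuousLinearMap.comp (M₁ := E) (M₂ := TangentSpace 𝓘(ℝ, F) (φ z))
      (M₃ := F) (eN.continuousLinearMapAt ℝ (φ z))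
      (mfderiv 𝓘(ℝ, E) 𝓘(ℝ, F) φ z ∘L eM.symmL ℝ z) := fun z ↦ rfl
  have hDx : D x = mfderiv 𝓘(ℝ, E) 𝓘(ℝ, F) φ x := by
    ext v
    refine (tangentCoordinates_self (φ x) _).trans ?_
    exact congrArg (mfderiv 𝓘(ℝ, E) 𝓘(ℝ, F) φ x) (tangentCoordinates_symm_self x v)
  have hux : u x = (s x).1 := endCoord_self _ _
  have hwx : w x = (Φ x (s x)).1 := endCoord_self _ _
  have hxM : ∀ᶠ z in 𝓝 x, z ∈ eM.baseSet :=
    eM.open_baseSet.mem_nhds (FiberBundle.mem_baseSet_trivializationAt' x)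
  have hxN : ∀ᶠ z in 𝓝 x, φ z ∈ eN.baseSet :=
    h.contMDiff.continuous.continuousAt.eventually (eN.open_baseSet.mem_nhds
      (FiberBundle.mem_baseSet_trivializationAt' (φ x)))
  have hcomm : (fun z ↦ ContinuousLinearMap.compL ℝ E E F (D z) (u z)) =ᶠ[𝓝 x]
      fun z ↦ ContinuousLinearMap.compL ℝ E F F (w z) (D z) := by
    filter_upwards [hxM, hxN] with z hz hz'
    ext v
    have h1 : D z (u z v) = eN.continuousLinearMapAt ℝ (φ z) (mfderiv 𝓘(ℝ, E) 𝓘(ℝ, F) φ z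
        (eM.symmL ℝ z (eM.continuousLinearMapAt ℝ z ((s z).1 (eM.symmL ℝ z v))))) := rfl
    have h2 : w z (D z v) = eN.continuousLinearMapAt ℝ (φ z) ((Φ z (s z)).1
        (eN.symmL ℝ (φ z) (eN.continuousLinearMapAt ℝ (φ z) (mfderiv 𝓘(ℝ, E) 𝓘(ℝ, F) φ z
          (eM.symmL ℝ z v))))) := rfl
    rw [Trivialization.symmL_continuousLinearMapAt _ hz] at h1
    rw [Trivialization.symmL_continuousLinearMapAt _ hz'] at h2
    refine h1.trans (Eq.trans ?_ h2.symm)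
    exact congrArg (fun L : TangentSpace 𝓘(ℝ, E) z →L[ℝ] TangentSpace 𝓘(ℝ, F) (φ z) ↦
      eN.continuousLinearMapAt ℝ (φ z) (L (eM.symmL ℝ z v))) (h.quaternionic z (s z))
  have h1 := mfderiv_of_bilinear (ContinuousLinearMap.compL ℝ E E F) hDd hud X
  have h2 := mfderiv_of_bilinear (ContinuousLinearMap.compL ℝ E F F) hwd hDd X
  have h3 := congrArg (fun L : E →L[ℝ] (E →L[ℝ] F) ↦ L X)
    (hcomm.mfderiv_eq (I := 𝓘(ℝ, E)) (I' := 𝓘(ℝ, E →L[ℝ] F)))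
  have h4 := h1.symm.trans (h3.trans h2)
  have key : ∀ (d D₀ D' : E →L[ℝ] F) (u₀ u' J : E →L[ℝ] E) (w₀ w' W : F →L[ℝ] F),
      D₀ = d → u₀ = J → w₀ = W → D₀ ∘L u' + D' ∘L u₀ = w₀ ∘L D' + w' ∘L D₀ →
      d ∘L u' + D' ∘L J = W ∘L D' + w' ∘L d := by
    rintro d D₀ D' u₀ u' J w₀ w' W rfl rfl rfl h
    exact h
  exact key _ _ _ _ _ _ _ _ _ hDx hux hwx h4

theorem hessian_complex (X Y : TangentSpace 𝓘(ℝ, E) x) :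
    hessian covM covN φ x X ((s x : EndT E x) Y)
      = (Φ x (s x) : EndT F (φ x)) (hessian covM covN φ x X Y)
        + connectionDifference covM covN Φ s x X (mfderiv 𝓘(ℝ, E) 𝓘(ℝ, F) φ x Y) := by
  have hu := connector_mfderiv covM (fun y : M ↦ y) (fun y ↦ (s y : EndT E y)) h.differentiable X
  have hw := connector_mfderiv covN φ (fun y ↦ (Φ y (s y) : EndT F (φ y)))
    (h.smooth.comp_curve (fun y : M ↦ y) s h.differentiable).1 X
  have hid : mfderiv 𝓘(ℝ, E) 𝓘(ℝ, E) (fun y : M ↦ y) x X = X :=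
    congrArg (fun L : E →L[ℝ] E ↦ L X) (mfderiv_id (I := 𝓘(ℝ, E)))
  rw [hid] at hu
  -- As `∇^M_X s` lies in `Q_M`, it can be moved across `dφ` by the linear extension; this produces
  -- the second term of `A(X)s`.
  have hC := (TwistorLift.linearExtension_spec h.quaternionic h.rank (h.section_mem X).1).2
  have hC' := congrArg (fun L : E →L[ℝ] F ↦ L Y) hC
  have key : ∀ (c₁ c₂ e₁ : F →L[ℝ] F) (c₀ e₀ : E →L[ℝ] E) (d : E →L[ℝ] F), c₁ = e₁ → c₀ = e₀ →
      d (c₀ Y) = c₂ (d Y) → (c₁ - c₂) (d Y) = e₁ (d Y) - d (e₀ Y) := by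
    rintro c₁ c₂ e₁ c₀ e₀ d rfl rfl h
    rw [sub_apply, h]
  have hA : connectionDifference covM covN Φ s x X (mfderiv 𝓘(ℝ, E) 𝓘(ℝ, F) φ x Y) = _ :=
    key _ _ _ _ _ _ hw hu hC'
  rw [hA]
  exact hessian_algebra (E := E) (F := F) (h.quaternionic x (s x)) (h.coordinate_derivative X) Y

end LocalTwistorSection
end ConnectionDifference

/-! ### The pointwise equivalences -/

section Equivalences

variable {E : Type*} [NormedAddCommGroup E] [NormedSpace ℝ E] [FiniteDimensional ℝ E]
  {M : Type*} [TopologicalSpace M] [ChartedSpace E M] [IsManifold 𝓘(ℝ, E) ∞ M]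
  {F : Type*} [NormedAddCommGroup F] [NormedSpace ℝ F] [FiniteDimensional ℝ F]
  {N : Type*} [TopologicalSpace N] [ChartedSpace F N] [IsManifold 𝓘(ℝ, F) ∞ N]
  {S : AlmostQuaternionicStructure E M} {T : AlmostQuaternionicStructure F N} {φ : M → N}

omit [FiniteDimensional ℝ E] [FiniteDimensional ℝ F] in
/-- If `h(X, J Y) = W h(X, Y) + a(X) (d Y)`, where `a(X)` lies in a quaternionic subspace and
anticommutes with `W`, then `h` maps `V^{1,0} × V^{0,1}` to `V^{0,1}` exactly when
`a(J X) = -W a(X)`. -/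
theorem complexBilinear_mem_eigenspace01_iff {Q : Submodule ℝ (F →L[ℝ] F)}
    (hQ : IsQuaternionicSubspace Q) {J : E →L[ℝ] E} {W : F →L[ℝ] F} {d : E →L[ℝ] F}
    {H : E → E → F} {a : E → (F →L[ℝ] F)} (hd : d ≠ 0) (hJ : J * J = -1) (hW : W * W = -1)
    (hWQ : W ∈ Q) (haQ : ∀ X, a X ∈ Q) (haW : ∀ X, a X * W = -(W * a X))
    (hneg : ∀ X, a (-X) = -a X) (hH : ∀ X Y, H X (J Y) = W (H X Y) + a X (d Y)) :
    (∀ z ∈ eigenspace10 J, ∀ w ∈ eigenspace01 J, complexBilinear H z w ∈ eigenspace01 W) ↔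
      ∀ X, a (J X) = -(W * a X) := by
  have hJ' : ∀ v, J (J v) = -v := fun v ↦ congrArg (fun f : E →L[ℝ] E ↦ f v) hJ
  have hW' : ∀ v, W (W v) = -v := fun v ↦ congrArg (fun f : F →L[ℝ] F ↦ f v) hW
  constructor
  · intro hyp X
    have hap : ∀ Y, a X (d Y) = W (a (J X) (d Y)) := by
      intro Y
      -- The test vectors are `X - iJX` and `Y + iJY`. The terms in `H` cancel by `hH` and `W² =
      -- -1`, without linearity of `H`.
      have h1 := (hyp (X, -J X) ⟨by simp, by simp [hJ']⟩ (Y, J Y) ⟨rfl, hJ' Y⟩).1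
      simp only [complexBilinear, hH, hneg, neg_apply, map_sub, map_add, map_neg, hW'] at h1
      have h2 : a X (d Y) - W (a (J X) (d Y)) = 0 := by
        rw [← sub_eq_zero] at h1
        refine Eq.trans ?_ (neg_eq_zero.2 h1)
        abel
      exact sub_eq_zero.1 h2
    obtain ⟨v, hv⟩ : ∃ v, d v ≠ 0 := by
      by_contra! hc
      exact hd (ContinuousLinearMap.ext hc)
    -- Anticommutation puts `W * a (J X)` back in `Q`, so equality at the single vector `d v ≠ 0`
    -- gives equality of operators.
    have hmem := Q.sub_mem (haQ X) (hQ.mul_mem_of_anticommute hWQ (haQ (J X)) (haW (J X)))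
    have h0 : a X - W * a (J X) = 0 := hQ.eq_zero_of_apply hmem hv (by simp [hap v])
    rw [sub_eq_zero.1 h0, ← mul_assoc, hW]
    simp
  · rintro hyp ⟨X, X'⟩ ⟨h1, h2⟩ ⟨Y, Y'⟩ ⟨h3, h4⟩
    simp only at h1 h2 h3 h4
    subst h3
    obtain rfl : X' = -J X := by rw [h1, neg_neg]
    have hap : ∀ v, a (J X) v = -W (a X v) := fun v ↦
      congrArg (fun f : F →L[ℝ] F ↦ f v) (hyp X)
    constructor
    · simp only [complexBilinear, hH, hneg, neg_apply, map_sub, map_add, map_neg, hW', hap]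
      abel
    · simp only [complexBilinear, hH, hneg, neg_apply, map_add, hW', hap]
      abel

/-- The tangent spaces at `p` and `q` have the same model, so vectors are kept fixed; this serves to
replace `Φ.toMap ⟨x, J⟩`, defined by cases, by `⟨φ x, Φ x J⟩`. -/
theorem isJPrime_congr {cov : TangentConnection E M}
    {p q : EndBundle E M} (h : p = q) (v w : E × (E →L[ℝ] E)) :
    IsJPrime S cov p v w ↔ IsJPrime S cov q v w := by
  subst h
  rfl

variable {covM : TangentConnection E M} {covN : TangentConnection F N}
  {Φ : TwistorLift S T φ}

omit [FiniteDimensional ℝ E] in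
theorem isJPrime_toMap_iff (x : M) (J : S.Z x)
    (v w : TangentSpace (EndModel E) (⟨x, J⟩ : EndBundle E M)) :
    IsJPrime T covN (Φ.toMap ⟨x, J⟩)
      (mfderivWithin (EndModel E) (EndModel F) Φ.toMap S.twistorSpace ⟨x, J⟩ v)
      (mfderivWithin (EndModel E) (EndModel F) Φ.toMap S.twistorSpace ⟨x, J⟩ w) ↔
    IsJPrime T covN ⟨φ x, Φ x J⟩ (Φ.tangentMap x J v) (Φ.tangentMap x J w) :=
  isJPrime_congr (Φ.toMap_mk x J) _ _

namespace LocalTwistorSection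

variable {s : ∀ x : M, S.Z x} {x : M} (h : LocalTwistorSection covM covN Φ s x)
include h

theorem hessian_iff :
    (∀ z ∈ eigenspace10 (s x : EndT E x), ∀ w ∈ eigenspace01 (s x : EndT E x),
      complexBilinear (hessian covM covN φ x) z w ∈ eigenspace01 (Φ x (s x) : EndT F (φ x))) ↔
    ∀ X : TangentSpace 𝓘(ℝ, E) x,
      connectionDifference covM covN Φ s x ((s x : EndT E x) X)
        = -((Φ x (s x) : EndT F (φ x)) ∘L connectionDifference covM covN Φ s x X) := by
  have := complexBilinear_mem_eigenspace01_iff (E := E) (F := F)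
    (T.isQuaternionicSubspace (φ x)) (J := (s x).1) (W := (Φ x (s x)).1)
    (d := mfderiv 𝓘(ℝ, E) 𝓘(ℝ, F) φ x) (H := hessian covM covN φ x)
    (a := fun X ↦ connectionDifference covM covN Φ s x X) h.rank (s x).2.2 (Φ x (s x)).2.2
    (Φ x (s x)).2.1 (fun X ↦ (h.connectionDifference_mem X).1)
    (fun X ↦ (h.connectionDifference_mem X).2) (fun X ↦ connectionDifference_neg X)
    (fun X Y ↦ h.hessian_complex X Y)
  exact this

/-- Compatibility of the differential of `Φ` with the almost complex structures `𝒥'` at a point. -/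
theorem isJPrime_iff :
    (∀ v w, IsJPrime S covM ⟨x, s x⟩ v w →
      IsJPrime T covN ⟨φ x, Φ x (s x)⟩ (Φ.tangentMap x (s x) v) (Φ.tangentMap x (s x) w)) ↔
    ∀ X : TangentSpace 𝓘(ℝ, E) x,
      connectionDifference covM covN Φ s x ((s x : EndT E x) X)
        = -((Φ x (s x) : EndT F (φ x)) ∘L connectionDifference covM covN Φ s x X) := by
  constructor
  · intro hyp X
    -- horizontal lifts
    have hlift : ∀ X : TangentSpace 𝓘(ℝ, E) x,
        ∃ v : TangentSpace (EndModel E) (⟨x, s x⟩ : EndBundle E M),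
          dproj ⟨x, s x⟩ v = X ∧ connector covM ⟨x, s x⟩ v = 0 := by
      intro X
      obtain ⟨h1, h2⟩ := h.section_mem X
      -- The horizontal lift is `ds(X)` minus the vertical vector with connector `∇^M_X s`.
      obtain ⟨w, hw1, hw2, -⟩ := TwistorLift.exists_vertical h.smooth h.quaternionic covM covN
        h.rank (s x) h1 h2
      refine ⟨mfderiv 𝓘(ℝ, E) (EndModel E) (fun y ↦ (⟨y, s y⟩ : EndBundle E M)) x X
        + (-1 : ℝ) • w, ?_, ?_⟩
      · refine (ContinuousLinearMap.map_add _ _ _).trans ?_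
        rw [ContinuousLinearMap.map_smul, hw1, smul_zero, h.dproj_section X]
        exact add_zero _
      · rw [connector_add, connector_smul, hw2, neg_one_smul]
        exact add_neg_cancel _
    have hhor : ∀ v : TangentSpace (EndModel E) (⟨x, s x⟩ : EndBundle E M),
        connector covM ⟨x, s x⟩ v = 0 → v ∈ twistorTangent S covM ⟨x, s x⟩ := by
      intro v hv
      refine ⟨by rw [hv]; exact (S.Q x).zero_mem, ?_⟩
      rw [hv, ContinuousLinearMap.zero_comp, ContinuousLinearMap.comp_zero, neg_zero]
    obtain ⟨v, hv1, hv2⟩ := hlift X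
    obtain ⟨w, hw1, hw2⟩ := hlift ((s x : EndT E x) X)
    have hvw : IsJPrime S covM ⟨x, s x⟩ v w := by
      refine ⟨hhor v hv2, hhor w hw2, by rw [hw1, hv1], ?_⟩
      rw [hv2, hw2, ContinuousLinearMap.comp_zero, neg_zero]
    -- On horizontal lifts of `X` and `JX` the vertical parts of the images are exactly `A(X)s` and
    -- `A(JX)s`.
    have himg := (hyp v w hvw).2.2.2
    rw [(h.tangentMap_apply (hhor v hv2)).2, (h.tangentMap_apply (hhor w hw2)).2, hv1, hw1, hv2,
      hw2, map_zero, zero_add, zero_add] at himg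
    exact himg
  · rintro hyp v w ⟨hv, hw, hvw1, hvw2⟩
    obtain ⟨hv1, hv2⟩ := h.tangentMap_apply hv
    obtain ⟨hw1, hw2⟩ := h.tangentMap_apply hw
    have key : ∀ A B J : F →L[ℝ] F, A * J = -(J * A) → B * J = -(J * B) →
        (A + B) * J = -(J * (A + B)) := by
      intro A B J hA hB
      rw [add_mul, hA, hB]
      noncomm_ring
    have htan : ∀ v : TangentSpace (EndModel E) (⟨x, s x⟩ : EndBundle E M),
        v ∈ twistorTangent S covM ⟨x, s x⟩ →
        Φ.tangentMap x (s x) v ∈ twistorTangent T covN ⟨φ x, Φ x (s x)⟩ := by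
      intro v hv
      have h1 := TwistorLift.linearExtension_spec h.quaternionic h.rank hv.1
      have h2 := TwistorLift.linearExtension_mul h.quaternionic h.rank (s x) hv.1 hv.2
      have h3 := h.connectionDifference_mem (dproj ⟨x, s x⟩ v)
      refine ⟨?_, ?_⟩
      · rw [(h.tangentMap_apply hv).2]
        exact (T.Q (φ x)).add_mem h1.1 h3.1
      · rw [(h.tangentMap_apply hv).2]
        exact key _ _ _ h2.1 h3.2
    refine ⟨htan v hv, htan w hw, ?_, ?_⟩
    · rw [hw1, hv1, hvw1]
      exact congrArg (fun L : E →L[ℝ] F ↦ L (dproj ⟨x, s x⟩ v)) (h.quaternionic x (s x))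
    -- The vertical part splits into `L B`, where compatibility is automatic from `L(J ∘ B) = Φ(J) ∘
    -- L B`, and `A(X)s`, where it is the hypothesis.
    · rw [hw2, hv2, hvw1, hyp, hvw2, map_neg,
        (TwistorLift.linearExtension_mul h.quaternionic h.rank (s x) hv.1 hv.2).2]
      have key' : ∀ W A B : F →L[ℝ] F, -(W * A) + -(W * B) = -(W * (A + B)) := by
        intros; noncomm_ring
      exact key' _ _ _

end LocalTwistorSection
end Equivalences

end

/-! ### Globalization of the pointwise equivalences -/

theorem proposition3p4
    {E : Type*} [NormedAddCommGroup E] [NormedSpace ℝ E] [FiniteDimensional ℝ E]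
    {M : Type*} [TopologicalSpace M] [ChartedSpace E M] [IsManifold 𝓘(ℝ, E) ∞ M]
    {F : Type*} [NormedAddCommGroup F] [NormedSpace ℝ F] [FiniteDimensional ℝ F]
    {N : Type*} [TopologicalSpace N] [ChartedSpace F N] [IsManifold 𝓘(ℝ, F) ∞ N]
    (S : AlmostQuaternionicStructure E M) (T : AlmostQuaternionicStructure F N)
    (covM : TangentConnection E M) (covN : TangentConnection F N)
    (hM : IsAlmostQuaternionicConnection S covM) (hN : IsAlmostQuaternionicConnection T covN)
    (φ : M → N) (hφ : ContMDiff 𝓘(ℝ, E) 𝓘(ℝ, F) ∞ φ)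
    (hrank : ∀ x : M, mfderiv 𝓘(ℝ, E) 𝓘(ℝ, F) φ x ≠ 0)
    (Φ : TwistorLift S T φ) (hΦ : Φ.IsSmooth) (hquat : IsQuaternionicMap Φ) :
    (IsTwistorialPrime covM covN Φ ↔
      ∀ (x : M) (J : S.Z x), ∀ z ∈ eigenspace10 (J : EndT E x), ∀ w ∈ eigenspace01 (J : EndT E x),
        complexBilinear (hessian covM covN φ x) z w ∈ eigenspace01 (Φ x J : EndT F (φ x))) ∧
    (IsTwistorialPrime covM covN Φ ↔
      ∀ (U : Set M) (s : ∀ x : M, S.Z x), IsOpen U → SmoothEndOn (fun x ↦ (s x : EndT E x)) U →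
        ∀ x ∈ U, ∀ X : TangentSpace 𝓘(ℝ, E) x,
          connectionDifference covM covN Φ s x ((s x : EndT E x) X)
            = -((Φ x (s x) : EndT F (φ x)) ∘L connectionDifference covM covN Φ s x X)) := by
  have hlocal : ∀ (s : ∀ x : M, S.Z x) (x : M), MDifferentiableAt 𝓘(ℝ, E) (EndModel E)
      (fun y ↦ (⟨y, s y⟩ : EndBundle E M)) x → LocalTwistorSection covM covN Φ s x :=
    fun s x hs ↦ ⟨hM, hN, hφ, hrank x, hΦ, hquat, hs⟩
  have hsections : IsTwistorialPrime covM covN Φ ↔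
      ∀ (U : Set M) (s : ∀ x : M, S.Z x), IsOpen U → SmoothEndOn (fun x ↦ (s x : EndT E x)) U →
        ∀ x ∈ U, ∀ X : TangentSpace 𝓘(ℝ, E) x,
          connectionDifference covM covN Φ s x ((s x : EndT E x) X)
            = -((Φ x (s x) : EndT F (φ x)) ∘L connectionDifference covM covN Φ s x X) := by
    constructor
    · rintro ⟨-, hyp⟩ U s hU hs x hx
      refine (hlocal s x (hs.mdifferentiableAt hU hx)).isJPrime_iff.1 fun v w hvw ↦ ?_
      exact (isJPrime_toMap_iff x (s x) v w).1 (hyp ⟨x, s x⟩ (s x).2 v w hvw)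
    · refine fun hyp ↦ ⟨hΦ, ?_⟩
      rintro ⟨x, J⟩ hJ v w hvw
      have := (nontrivial_of_mfderiv_ne_zero (hrank x)).1
      -- Any point of `Z_M` is the value of a smooth local section, to which the pointwise criterion
      -- applies.
      obtain ⟨U, s, hU, hxU, hs, hsx⟩ := exists_twistor_section S x ⟨J, hJ⟩
      obtain rfl : (s x : EndT E x) = J := congrArg Subtype.val hsx
      refine (isJPrime_toMap_iff x (s x) v w).2 ?_
      exact (hlocal s x (hs.mdifferentiableAt hU hxU)).isJPrime_iff.2 (hyp U s hU hs x hxU) v w hvw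
  refine ⟨hsections.trans ⟨fun hyp x J ↦ ?_, fun hyp U s hU hs x hx ↦ ?_⟩, hsections⟩
  · have := (nontrivial_of_mfderiv_ne_zero (hrank x)).1
    obtain ⟨U, s, hU, hxU, hs, rfl⟩ := exists_twistor_section S x J
    exact (hlocal s x (hs.mdifferentiableAt hU hxU)).hessian_iff.2 (hyp U s hU hs x hxU)
  -- The Hessian condition involves only the value of `s` at `x`.
  · exact (hlocal s x (hs.mdifferentiableAt hU hx)).hessian_iff.1 (hyp x (s x))
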